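/- Conventions. A finite simplicial complex $K$ is a finite family of finite sets (faces) closed under taking subsets; its vertices are the $v$ with $\{v\}\in K$, $\dim\sigma=|\sigma|-1$ and $\dim K=\max_{\sigma\in K}\dim\sigma$. For $\sigma\in K$ let $\mathrm{lk}_K(\sigma)=\{\tau\in K:\sigma\cap\tau=\emptyset,\ \sigma\cup\tau\in K\}$; let $K*L=\{\sigma\cup\tau:\sigma\in K,\tau\in L\}$ and $\partial F=2^F\setminus\{F\}$. A missing face of $K$ is a set $M\notin K$ all of whose proper subsets are faces of $K$. With $n=\dim K+1$ and $f_{j-1}$ the number of faces with $j$ elements, $h(K,t)=\sum_{m=0}^n h_mt^m$ where $h_m=\sum_{j=0}^m(-1)^{m-j}\binom{n-j}{m-j}f_{j-1}$. Fix an integral domain $R$ of coefficients (for example $\mathbb Z$ or a field). A $(d-1)$-dimensional complex $K$ is a homology sphere if for every face $\sigma$ (including $\emptyset$) the reduced simplicial homology of $\mathrm{lk}_K(\sigma)$ over $R$ is $R$ in dimension $d-1-|\sigma|$ and $0$ in all other dimensions. For $i\ge 1$, $d\ge 0$, let $\mathcal{HS}(i,d)$ be the family of $(d-1)$-dimensional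 homology spheres without missing faces of dimension $>i$. For $d\ge1$ let $P_{d,i}(t)=(1+t+\dots+t^i)^q(1+t+\dots+t^r)$, where $d=qi+r$ with $q\ge0$ and $1\le r\le i$, and let $P_{0,i}=1$. The polynomials $t^jP_{d-2j,i}(t)$, $0\le j\le\lfloor d/2\rfloor$, are linearly independent; for $\Delta\in\mathcal{HS}(i,d)$ let $g^{(i)}(\Delta)$ be the vector of coefficients of $h(\Delta,t)$ with respect to them. Theorem. Let $i,d\ge1$, let $\Delta\in\mathcal{HS}(i,d)$, let $F$ be a nonempty face of $\Delta$ of dimension $\le i$, let $v_F$ be a point that is not a vertex of $\Delta$, and let $$\Delta(F)=(\Delta\setminus\{T\in\Delta:F\subseteq T\})\ \cup\ \{\emptyset,\{v_F\}\}*\partial F*\mathrm{lk}_\Delta(F)$$ be the stellar subdivision of $\Delta$ at $F$. Then $\mathrm{lk}_\Delta(F)\in\mathcal{HS}(i,d-|F|)$ and $\Delta(F)\in\mathcal{HS}(i,d)$; the vectors $g^{(i)}(\Delta)$, $g^{(i)}(\mathrm{lk}_\Delta(F))$ and $g^{(i)}(\Delta(F))$ are defined (the three $h$-polynomials are integer combinations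 of the respective families above); and if $g^{(i)}(\Delta)\ge0$ and $g^{(i)}(\mathrm{lk}_\Delta(F))\ge0$ (componentwise), then $g^{(i)}(\Delta(F))\ge0$. -/

import Mathlib

open Finset Polynomial

noncomputable section

/-- A finite abstract simplicial complex with vertices in `V`: a finite family of finite sets
closed under taking subsets. The empty set is a face as soon as there is any face; the void family
is allowed because the boundary complex of the empty simplex is void. The vertices of the complex
are the `v` with `{v}` a face. -/
@[ext]
structure SimpComplex (V : Type*) where
  faces : Finset (Finset V)
  down_closed : ∀ σ ∈ faces, ∀ τ, τ ⊆ σ → τ ∈ faces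

namespace SimpComplex

section Combinatorics

variable {V : Type*} [DecidableEq V]

instance : Membership (Finset V) (SimpComplex V) := ⟨fun K σ => σ ∈ K.faces⟩

/-- The link `{τ ∈ K : σ ∩ τ = ∅, σ ∪ τ ∈ K}`. -/
def link (K : SimpComplex V) (σ : Finset V) : SimpComplex V where
  faces := {τ ∈ K.faces | Disjoint σ τ ∧ σ ∪ τ ∈ K.faces}
  down_closed := by
    intro τ hτ ρ hρ
    rw [Finset.mem_filter] at hτ ⊢
    exact ⟨K.down_closed τ hτ.1 ρ hρ, hτ.2.1.mono_right hρ,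
      K.down_closed _ hτ.2.2 _ (Finset.union_subset_union_right hρ)⟩

/-- The join `{σ ∪ τ : σ ∈ K, τ ∈ L}`. -/
def join (K L : SimpComplex V) : SimpComplex V where
  faces := Finset.image₂ (· ∪ ·) K.faces L.faces
  down_closed := by
    intro ρ hρ π hπ
    rw [Finset.mem_image₂] at hρ ⊢
    obtain ⟨σ, hσ, τ, hτ, rfl⟩ := hρ
    refine ⟨π ∩ σ, K.down_closed σ hσ _ Finset.inter_subset_right,
      π ∩ τ, L.down_closed τ hτ _ Finset.inter_subset_right, ?_⟩
    rw [← Finset.inter_union_distrib_left]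
    exact Finset.inter_eq_left.2 hπ

/-- The complex `{∅, {v}}` with a single vertex. -/
def point (v : V) : SimpComplex V where
  faces := ({v} : Finset V).powerset
  down_closed := fun _ hσ _ hτ =>
    Finset.mem_powerset.2 (hτ.trans (Finset.mem_powerset.1 hσ))

/-- The boundary complex `2^F \ {F}`. -/
def boundaryComplex (F : Finset V) : SimpComplex V where
  faces := F.ssubsets
  down_closed := fun _ hσ _ hτ =>
    Finset.mem_ssubsets.2 (lt_of_le_of_lt hτ (Finset.mem_ssubsets.1 hσ))

/-- The stellar subdivision of `K` at `F` with new vertex `v`: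
`(K \ {T ∈ K : F ⊆ T}) ∪ {v} * ∂F * lk_K(F)`. -/
def stellar (K : SimpComplex V) (F : Finset V) (v : V) : SimpComplex V where
  faces := {T ∈ K.faces | ¬ F ⊆ T} ∪
    (join (point v) (join (boundaryComplex F) (K.link F))).faces
  down_closed := by
    intro σ hσ τ hτ
    rw [Finset.mem_union] at hσ ⊢
    rcases hσ with hσ | hσ
    · rw [Finset.mem_filter] at hσ
      exact Or.inl (Finset.mem_filter.2
        ⟨K.down_closed σ hσ.1 τ hτ, fun h => hσ.2 (h.trans hτ)⟩)
    · exact Or.inr (SimpComplex.down_closed _ σ hσ τ hτ)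

/-- `M` is a missing face of `K`: it is not a face, but all its proper subsets are. -/
def IsMissingFace (K : SimpComplex V) (M : Finset V) : Prop :=
  M ∉ K ∧ ∀ τ, τ ⊂ M → τ ∈ K

/-- `dim K + 1`, the largest cardinality of a face. -/
def size (K : SimpComplex V) : ℕ := K.faces.sup Finset.card

/-- The number `f_{j-1}(K)` of faces with `j` elements. -/
def fNum (K : SimpComplex V) (j : ℕ) : ℕ := #{σ ∈ K.faces | #σ = j}

/-- The `h`-numbers `h_m = ∑_{j ≤ m} (-1)^{m-j} C(n-j, m-j) f_{j-1}`, where `n = dim K + 1`. -/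
def hNum (K : SimpComplex V) (m : ℕ) : ℤ :=
  ∑ j ∈ Finset.range (m + 1),
    (-1) ^ (m - j) * ((K.size - j).choose (m - j) : ℤ) * (K.fNum j : ℤ)

/-- The `h`-polynomial. -/
def hPoly (K : SimpComplex V) : ℤ[X] :=
  ∑ m ∈ Finset.range (K.size + 1), C (K.hNum m) * X ^ m

end Combinatorics

section Homology

variable {V : Type*} [LinearOrder V] (R : Type*) [CommRing R]

/-- The augmented simplicial boundary map on formal combinations of finite sets of vertices,
`∂ {v_0 < ... < v_n} = ∑_k (-1)^k {v_0, ..., v_n} \ {v_k}`, including `∂ {v} = ∅` and `∂ ∅ = 0`. -/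
def boundaryMap : (Finset V →₀ R) →ₗ[R] (Finset V →₀ R) :=
  Finsupp.linearCombination R fun σ : Finset V =>
    ∑ v ∈ σ, Finsupp.single (σ.erase v) ((-1 : R) ^ #{w ∈ σ | w < v})

/-- The chains of `K` on faces with `m` elements, that is, of dimension `m - 1`. -/
def chains (K : SimpComplex V) (m : ℕ) : Submodule R (Finset V →₀ R) :=
  Finsupp.supported R R {σ | σ ∈ K ∧ #σ = m}

/-- The `(m-1)`-cycles of the augmented chain complex of `K`. -/
def cycles (K : SimpComplex V) (m : ℕ) : Submodule R (Finset V →₀ R) :=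
  K.chains R m ⊓ LinearMap.ker (boundaryMap R)

/-- The `(m-1)`-boundaries of the augmented chain complex of `K`. -/
def boundaries (K : SimpComplex V) (m : ℕ) : Submodule R (Finset V →₀ R) :=
  (K.chains R (m + 1)).map (boundaryMap R)

/-- The reduced simplicial homology of `K` in dimension `m - 1` with coefficients in `R`: cycles
modulo boundaries, as the image of the cycles in the quotient of all chains by the boundaries. -/
def reducedHomology (K : SimpComplex V) (m : ℕ) :
    Submodule R ((Finset V →₀ R) ⧸ K.boundaries R m) :=
  (K.cycles R m).map (K.boundaries R m).mkQ

/-- `K` is a `(d-1)`-dimensional homology sphere over `R`: it has dimension `d - 1`, and the link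
of every face `σ` (including `σ = ∅`) has the reduced homology of a sphere of dimension
`d - 1 - |σ|`. -/
def IsHomologySphere (K : SimpComplex V) (d : ℕ) : Prop :=
  K.faces.Nonempty ∧ K.size = d ∧ ∀ σ ∈ K, ∀ m : ℕ,
    (m + #σ = d → Nonempty ((K.link σ).reducedHomology R m ≃ₗ[R] R)) ∧
    (m + #σ ≠ d → Subsingleton ((K.link σ).reducedHomology R m))

/-- The family `HS(i,d)`: homology spheres over `R` of dimension `d - 1` without missing faces of
dimension larger than `i`. -/
def IsHS (i d : ℕ) (K : SimpComplex V) : Prop :=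
  K.IsHomologySphere R d ∧ ∀ M, K.IsMissingFace M → #M ≤ i + 1

end Homology

end SimpComplex

/-- The polynomial `1 + t + ... + t^n`. -/
def geomPoly (n : ℕ) : ℤ[X] := ∑ k ∈ Finset.range (n + 1), X ^ k

/-- `P_{d,i} = (1 + ... + t^i)^q (1 + ... + t^r)` where `d = q i + r` with `q ≥ 0`, `1 ≤ r ≤ i`
(so `q = (d-1) / i` and `r = (d-1) % i + 1`) if `d ≥ 1`; and `P_{0,i} = 1`. -/
def gP (d i : ℕ) : ℤ[X] :=
  if d = 0 then 1 else geomPoly i ^ ((d - 1) / i) * geomPoly ((d - 1) % i + 1)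

/-- The family `B_{d,i} = (t^j P_{d-2j,i})`, `0 ≤ j ≤ ⌊d/2⌋`. -/
def gBasis (i d : ℕ) (j : Fin (d / 2 + 1)) : ℤ[X] := X ^ (j : ℕ) * gP (d - 2 * j) i

theorem geomPoly_coeff_zero (n : ℕ) : (geomPoly n).coeff 0 = 1 := by
  simp [geomPoly, Polynomial.coeff_X_pow]

theorem gP_coeff_zero (d i : ℕ) : (gP d i).coeff 0 = 1 := by
  unfold gP
  split_ifs
  · simp
  · rw [Polynomial.mul_coeff_zero, Polynomial.coeff_zero_eq_eval_zero (geomPoly i ^ _),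
      Polynomial.eval_pow, ← Polynomial.coeff_zero_eq_eval_zero, geomPoly_coeff_zero,
      geomPoly_coeff_zero]
    simp

theorem linearIndependent_gBasis (i d : ℕ) : LinearIndependent ℤ (gBasis i d) := by
  rw [Fintype.linearIndependent_iff]
  intro c hc
  have key : ∀ n : ℕ, ∀ j : Fin (d / 2 + 1), (j : ℕ) = n → c j = 0 := by
    intro n
    induction n using Nat.strong_induction_on with
    | _ n ih =>
      intro j hj
      have h := congrArg (fun p : ℤ[X] => p.coeff n) hc
      simp only [Polynomial.finsetSum_coeff, Polynomial.coeff_zero, Polynomial.coeff_smul,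
        smul_eq_mul, gBasis] at h
      rw [Finset.sum_eq_single j] at h
      · subst hj
        simpa [Polynomial.coeff_X_pow_mul', gP_coeff_zero] using h
      · intro k _ hk
        have hkn : (k : ℕ) ≠ n := fun e => hk (Fin.ext (e.trans hj.symm))
        rcases lt_or_gt_of_ne hkn with h1 | h1
        · rw [ih k h1 k rfl, zero_mul]
        · rw [Polynomial.coeff_X_pow_mul', if_neg (by omega), mul_zero]
      · simp
  exact fun j => key j j rfl

/-- `p` can be expressed in the basis `B_{d,i}`. -/
def InGSpan (i d : ℕ) (p : ℤ[X]) : Prop := p ∈ Submodule.span ℤ (Set.range (gBasis i d))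

open Classical in
/-- The vector `g^{(d,i)}(p)` of coefficients of `p` in the basis `B_{d,i}` (with the value `0` if
`p` cannot be expressed in it). -/
def gVector (i d : ℕ) (p : ℤ[X]) : Fin (d / 2 + 1) → ℤ :=
  if hp : InGSpan i d p then ⇑((linearIndependent_gBasis i d).repr ⟨p, hp⟩) else 0

end

/-!
A homology sphere has a palindromic `h`-polynomial (Dehn–Sommerville, from the Euler characteristics
of its links), so its `h`-polynomial is an integer combination of the `t^j P_{d-2j,i}`.

Both `Δ` and its stellar subdivision `Δ(F)` are subcomplexes of the union of `Δ` with the cone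
`v * S` over the closed star `S` of `F`. The faces of this union outside `Δ` come in pairs differing
by a vertex of `F`, those outside `Δ(F)` in pairs differing by `v`, so all three have the same
homology. The link in `Δ(F)` of a face `T` without `v` is a link in `Δ` or a stellar subdivision of
one, and the link of `T ∪ {v}` is `∂(F \ T) * lk(T ∪ F)`, an iterated suspension up to homology.
Hence `Δ(F)` is a homology sphere.

On `h`-polynomials, `h(Δ(F)) = h(Δ) + t (1 + ⋯ + t^(|F|-2)) h(lk(F))`. With `[n] = 1 + ⋯ + t^(n-1)`,
the identity `[b+1+e] [b+1] = [b+2+e] [b] + t^(b+1) [e]` shows that multiplication by `1 + ⋯ + t^a`,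
`a ≤ i`, takes nonnegative combinations of the `t^j P_{d-2j,i}` to nonnegative combinations of the
`t^j P_{d+a-2j,i}`.
-/

section GCone

theorem mul_mem_of_mem_span {R A : Type*} [CommSemiring R] [Semiring A] [Algebra R A]
    {s : Set A} {N : Submodule R A} {a p : A} (h : ∀ b ∈ s, a * b ∈ N)
    (hp : p ∈ Submodule.span R s) : a * p ∈ N :=
  (Submodule.span_le (p := N.comap (LinearMap.mulLeft R a))).2 h hp

/-- The cone of combinations of the family `B_{d,i}` with non-negative integer coefficients,
encoded as a span over the semiring `ℕ`. -/
noncomputable def gCone (i d : ℕ) : Submodule ℕ ℤ[X] := Submodule.span ℕ (Set.range (gBasis i d))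

variable {i d e j : ℕ} {p : ℤ[X]}

theorem mem_gCone_iff_gVector_nonneg (hp : InGSpan i d p) :
    p ∈ gCone i d ↔ 0 ≤ gVector i d p := by
  have hrepr : ∑ j, gVector i d p j • gBasis i d j = p := by
    have h := (linearIndependent_gBasis i d).linearCombination_repr ⟨p, hp⟩
    rw [Finsupp.linearCombination_apply, Finsupp.sum_fintype _ _ (by simp)] at h
    rwa [gVector, dif_pos hp]
  rw [gCone, Submodule.mem_span_range_iff_exists_fun]
  constructor
  · rintro ⟨c, hc⟩
    have hcoeff : (fun j => (c j : ℤ)) = gVector i d p :=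
      funext (Fintype.linearIndependent_iffₛ.1 (linearIndependent_gBasis i d)
        (fun j => (c j : ℤ)) (gVector i d p) (by simp only [natCast_zsmul, hc, hrepr]))
    rw [← hcoeff]
    exact fun j => Int.natCast_nonneg _
  · intro h
    refine ⟨fun j => (gVector i d p j).toNat, ?_⟩
    conv_rhs => rw [← hrepr]
    refine sum_congr rfl fun j _ => ?_
    rw [← natCast_zsmul, Int.toNat_of_nonneg (h j)]

theorem X_pow_mul_gP_mem_range (h : e + 2 * j = d) :
    X ^ j * gP e i ∈ Set.range (gBasis i d) :=
  ⟨⟨j, by omega⟩, by simp [gBasis, ← h]⟩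

theorem gP_mem_range (i d : ℕ) : gP d i ∈ Set.range (gBasis i d) := by
  simpa using X_pow_mul_gP_mem_range (i := i) (j := 0) (add_zero d)

theorem X_pow_mul_mem_span_gBasis {R : Type*} [CommSemiring R] [Algebra R ℤ[X]]
    (h : e + 2 * j = d) (hp : p ∈ Submodule.span R (Set.range (gBasis i e))) :
    X ^ j * p ∈ Submodule.span R (Set.range (gBasis i d)) := by
  refine mul_mem_of_mem_span ?_ hp
  rintro _ ⟨k, rfl⟩
  rw [gBasis, ← mul_assoc, ← pow_add]
  exact Submodule.subset_span (X_pow_mul_gP_mem_range (by omega))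

theorem geomPoly_zero : geomPoly 0 = 1 := by simp [geomPoly]

theorem geomPoly_succ (n : ℕ) : geomPoly (n + 1) = geomPoly n + X ^ (n + 1) :=
  sum_range_succ _ _

theorem X_sub_one_mul_geomPoly (n : ℕ) : (X - 1) * geomPoly n = X ^ (n + 1) - 1 :=
  mul_geom_sum X (n + 1)

theorem geomPoly_mul_geomPoly_succ (b e : ℕ) :
    geomPoly (b + 1 + e) * geomPoly (b + 1) =
      geomPoly (b + 1 + e + 1) * geomPoly b + X ^ (b + 1) * geomPoly e := by
  have hX : (X - 1 : ℤ[X]) ≠ 0 := X_sub_C_ne_zero 1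
  apply mul_left_cancel₀ (mul_ne_zero hX hX)
  calc (X - 1) * (X - 1) * (geomPoly (b + 1 + e) * geomPoly (b + 1))
      = ((X - 1) * geomPoly (b + 1 + e)) * ((X - 1) * geomPoly (b + 1)) := by ring
    _ = ((X - 1) * geomPoly (b + 1 + e + 1)) * ((X - 1) * geomPoly b) +
        (X - 1) * X ^ (b + 1) * ((X - 1) * geomPoly e) := by
      simp only [X_sub_one_mul_geomPoly]; ring
    _ = (X - 1) * (X - 1) *
        (geomPoly (b + 1 + e + 1) * geomPoly b + X ^ (b + 1) * geomPoly e) := by ring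

theorem gP_mul_add (hi : 1 ≤ i) (q : ℕ) {s : ℕ} (hs : s ≤ i) :
    gP (q * i + s) i = geomPoly i ^ q * geomPoly s := by
  have gP_of_pos (q : ℕ) {s : ℕ} (hs0 : 1 ≤ s) (hs : s ≤ i) :
      gP (q * i + s) i = geomPoly i ^ q * geomPoly s := by
    rw [gP, if_neg (by omega), Nat.add_sub_assoc hs0, add_comm, Nat.add_mul_div_right _ _ hi,
      Nat.add_mul_mod_self_right, Nat.div_eq_of_lt (by omega), Nat.mod_eq_of_lt (by omega),
      zero_add, Nat.sub_add_cancel hs0]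
  rcases s.eq_zero_or_pos with rfl | hs0
  · cases q with
    | zero => simp [gP, geomPoly_zero]
    | succ q => rw [add_zero, Nat.succ_mul, gP_of_pos q hi le_rfl, geomPoly_zero, pow_succ, mul_one]
  · exact gP_of_pos q hs0 hs

theorem gP_eq_geomPoly_pow_mul (hi : 1 ≤ i) (n : ℕ) :
    gP n i = geomPoly i ^ (n / i) * geomPoly (n % i) := by
  rw [← gP_mul_add hi _ (Nat.mod_lt n hi).le, Nat.div_add_mod']

theorem geomPoly_pow_mul_mem_gCone (hi : 1 ≤ i) (q : ℕ) {r a : ℕ} (hra : r ≤ a) (ha : a ≤ i) :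
    geomPoly i ^ q * (geomPoly a * geomPoly r) ∈ gCone i (q * i + a + r) := by
  induction r generalizing a with
  | zero =>
    rw [geomPoly_zero, mul_one, add_zero, ← gP_mul_add hi q ha]
    exact Submodule.subset_span (gP_mem_range _ _)
  | succ b ih =>
    rcases ha.eq_or_lt with rfl | hlt
    · rw [← mul_assoc, ← pow_succ, ← Nat.succ_mul, ← gP_mul_add hi (q + 1) hra]
      exact Submodule.subset_span (gP_mem_range _ _)
    · obtain ⟨e, rfl⟩ := Nat.exists_eq_add_of_le hra
      rw [geomPoly_mul_geomPoly_succ, mul_add]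
      refine Submodule.add_mem _ ?_ ?_
      · convert ih (a := b + 1 + e + 1) (by omega) hlt using 2
        ring
      · rw [mul_left_comm, ← gP_mul_add hi q (by omega)]
        exact Submodule.subset_span (X_pow_mul_gP_mem_range (by ring))

theorem geomPoly_mul_gP_mem_gCone {a : ℕ} (hi : 1 ≤ i) (ha : a ≤ i) (n : ℕ) :
    geomPoly a * gP n i ∈ gCone i (n + a) := by
  have hr : n % i ≤ i := (Nat.mod_lt n hi).le
  have hn : n / i * i + n % i = n := Nat.div_add_mod' n i
  rw [gP_eq_geomPoly_pow_mul hi, mul_left_comm]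
  rcases le_total (n % i) a with h | h
  · convert geomPoly_pow_mul_mem_gCone hi (n / i) h ha using 1
    rw [add_right_comm, hn]
  · convert geomPoly_pow_mul_mem_gCone hi (n / i) h hr using 1
    · rw [hn]
    · rw [mul_comm (geomPoly a)]

theorem geomPoly_mul_mem_gCone {a : ℕ} (hi : 1 ≤ i) (ha : a ≤ i) (hp : p ∈ gCone i d) :
    geomPoly a * p ∈ gCone i (d + a) := by
  refine mul_mem_of_mem_span ?_ hp
  rintro _ ⟨k, rfl⟩
  rw [gBasis, mul_left_comm]
  exact X_pow_mul_mem_span_gBasis (by omega) (geomPoly_mul_gP_mem_gCone hi ha (d - 2 * k))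

end GCone

section Palindromic

/-- `p` has degree at most `d` and symmetric coefficients, that is, `t^d p(1/t) = p(t)`. The bound
on the degree is a separate clause because `Polynomial.reflect d` fixes the coefficients beyond
`d`. -/
def IsPalindromic {R : Type*} [Semiring R] (d : ℕ) (p : R[X]) : Prop :=
  p.natDegree ≤ d ∧ p.reflect d = p

theorem isPalindromic_iff_coeff {R : Type*} [Semiring R] {d : ℕ} {p : R[X]} :
    IsPalindromic d p ↔
      (∀ k, d < k → p.coeff k = 0) ∧ ∀ k ≤ d, p.coeff (d - k) = p.coeff k := by
  rw [IsPalindromic, natDegree_le_iff_coeff_eq_zero, Polynomial.ext_iff]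
  refine and_congr_right fun _ => forall_congr' fun k => ?_
  rw [coeff_reflect]
  rcases le_or_gt k d with hk | hk
  · rw [revAt_le hk, forall_prop_of_true hk]
  · simp only [revAt_eq_self_of_lt hk, hk.not_ge, false_imp_iff]

namespace IsPalindromic

section Semiring

variable {R : Type*} [Semiring R] {d e : ℕ} {p q : R[X]}

theorem one : IsPalindromic 0 (1 : R[X]) := by simp [IsPalindromic]

theorem mul (hp : IsPalindromic d p) (hq : IsPalindromic e q) :
    IsPalindromic (d + e) (p * q) :=
  ⟨natDegree_mul_le_of_le hp.1 hq.1, by rw [reflect_mul _ _ hp.1 hq.1, hp.2, hq.2]⟩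

theorem pow (hp : IsPalindromic d p) (n : ℕ) : IsPalindromic (n * d) (p ^ n) := by
  induction n with
  | zero => simpa using one
  | succ n ih =>
    rw [pow_succ, Nat.succ_mul]
    exact ih.mul hp

theorem divX (hp : IsPalindromic (d + 2) p) (h0 : p.coeff 0 = 0) : IsPalindromic d p.divX := by
  rw [isPalindromic_iff_coeff] at hp ⊢
  obtain ⟨hhigh, hsymm⟩ := hp
  have htop : p.coeff (d + 2) = 0 := (hsymm 0 (Nat.zero_le _)).trans h0
  refine ⟨fun k hk => ?_, fun k hk => ?_⟩
  · rw [coeff_divX]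
    rcases (Nat.succ_le_of_lt hk).eq_or_lt with rfl | hk
    · exact htop
    · exact hhigh _ (by omega)
  · rw [coeff_divX, coeff_divX, ← hsymm (k + 1) (by omega)]
    congr 1
    omega

theorem eq_zero_of_lt_two (hp : IsPalindromic d p) (hd : d < 2) (h0 : p.coeff 0 = 0) :
    p = 0 := by
  obtain ⟨hhigh, hsymm⟩ := isPalindromic_iff_coeff.1 hp
  ext k
  rw [coeff_zero]
  obtain hk | rfl | rfl : d < k ∨ k = 0 ∨ k = d := by omega
  · exact hhigh k hk
  · exact h0
  · rw [← hsymm k le_rfl, Nat.sub_self, h0]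

end Semiring

variable {R : Type*} [CommRing R] {d : ℕ} {p q : R[X]}

theorem sub (hp : IsPalindromic d p) (hq : IsPalindromic d q) : IsPalindromic d (p - q) :=
  ⟨natDegree_sub_le_of_le hp.1 hq.1 |>.trans (max_self d).le, by rw [reflect_sub, hp.2, hq.2]⟩

theorem C_mul (hp : IsPalindromic d p) (a : R) : IsPalindromic d (C a * p) :=
  ⟨(natDegree_C_mul_le a p).trans hp.1, by rw [reflect_C_mul, hp.2]⟩

end IsPalindromic

theorem isPalindromic_geomPoly (n : ℕ) : IsPalindromic n (geomPoly n) := by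
  have coeff_geomPoly (k : ℕ) : (geomPoly n).coeff k = if k ≤ n then 1 else 0 := by
    simp [geomPoly, coeff_X_pow]
  rw [isPalindromic_iff_coeff]
  refine ⟨fun k hk => ?_, fun k hk => ?_⟩
  · rw [coeff_geomPoly, if_neg hk.not_ge]
  · rw [coeff_geomPoly, coeff_geomPoly, if_pos (Nat.sub_le n k), if_pos hk]

theorem isPalindromic_gP {i : ℕ} (hi : 1 ≤ i) (d : ℕ) : IsPalindromic d (gP d i) := by
  have h := ((isPalindromic_geomPoly i).pow (d / i)).mul (isPalindromic_geomPoly (d % i))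
  rwa [← gP_eq_geomPoly_pow_mul hi, Nat.div_add_mod'] at h

theorem IsPalindromic.inGSpan {i d : ℕ} {p : ℤ[X]} (hi : 1 ≤ i) (hp : IsPalindromic d p) :
    InGSpan i d p := by
  induction d using Nat.strong_induction_on generalizing p with
  | _ d ih =>
    set r := p - C (p.coeff 0) * gP d i with hr
    have hr_pal : IsPalindromic d r := hp.sub ((isPalindromic_gP hi d).C_mul _)
    have hr0 : r.coeff 0 = 0 := by simp [hr, gP_coeff_zero]
    suffices hr_span : InGSpan i d r by
      have hP : InGSpan i d (gP d i) := Submodule.subset_span (gP_mem_range i d)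
      have hpr : p = r + p.coeff 0 • gP d i := by rw [hr, smul_eq_C_mul, sub_add_cancel]
      rw [hpr]
      exact Submodule.add_mem _ hr_span (Submodule.smul_mem _ _ hP)
    rcases Nat.lt_or_ge d 2 with hd | hd
    · rw [hr_pal.eq_zero_of_lt_two hd hr0]
      exact Submodule.zero_mem _
    · obtain ⟨e, rfl⟩ := Nat.exists_eq_add_of_le' hd
      have hdivX : X ^ 1 * r.divX = r := by
        rw [pow_one, ← add_zero (X * r.divX), ← C_0, ← hr0, X_mul_divX_add]
      rw [← hdivX]
      exact X_pow_mul_mem_span_gBasis rfl (ih e (by omega) (hr_pal.divX hr0))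

end Palindromic

namespace SimpComplex

section Basic

variable {V : Type*} {K L : SimpComplex V} {σ : Finset V} {v : V}

theorem ext_mem (h : ∀ σ, σ ∈ K ↔ σ ∈ L) : K = L :=
  SimpComplex.ext (Finset.ext h)

theorem notMem_of_singleton_notMem (hv : {v} ∉ K) (hσ : σ ∈ K) : v ∉ σ :=
  fun h => hv (K.down_closed _ hσ _ (singleton_subset_iff.2 h))

theorem card_le_size (h : σ ∈ K) : #σ ≤ K.size := le_sup h

theorem exists_mem_card_eq_size (h : K.faces.Nonempty) : ∃ σ ∈ K, #σ = K.size := by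
  obtain ⟨σ, hσ, hcard⟩ := exists_mem_eq_sup K.faces h card
  exact ⟨σ, hσ, hcard.symm⟩

theorem exists_isMissingFace_subset (hσ : σ ∉ K) : ∃ M ⊆ σ, K.IsMissingFace M := by
  induction σ using Finset.strongInduction with
  | _ σ ih =>
    by_cases h : ∀ τ, τ ⊂ σ → τ ∈ K
    · exact ⟨σ, subset_rfl, hσ, h⟩
    · push Not at h
      obtain ⟨τ, hτσ, hτK⟩ := h
      obtain ⟨M, hMτ, hM⟩ := ih τ hτσ hτK
      exact ⟨M, hMτ.trans hτσ.1, hM⟩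

end Basic

section LinkJoin

variable {V : Type*} [DecidableEq V] {K L : SimpComplex V} {F G σ τ : Finset V} {g v x : V}

theorem mem_link : τ ∈ K.link σ ↔ Disjoint σ τ ∧ σ ∪ τ ∈ K :=
  mem_filter.trans
    ⟨fun h => h.2, fun h => ⟨K.down_closed _ h.2 _ subset_union_right, h⟩⟩

theorem mem_link_singleton : τ ∈ K.link {x} ↔ x ∉ τ ∧ insert x τ ∈ K := by
  rw [mem_link, disjoint_singleton_left, ← insert_eq]

theorem disjoint_of_mem_link (h : τ ∈ K.link σ) : Disjoint σ τ := (mem_link.1 h).1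

theorem link_link (h : Disjoint σ τ) : (K.link σ).link τ = K.link (σ ∪ τ) := by
  refine ext_mem fun ρ => ?_
  simp only [mem_link, disjoint_union_left, disjoint_union_right, union_assoc]
  tauto

theorem singleton_notMem_link (hv : {v} ∉ K) (σ : Finset V) : {v} ∉ K.link σ :=
  fun h => hv (K.down_closed _ (mem_link.1 h).2 _ subset_union_right)

theorem sdiff_mem_link (h : σ ∪ F ∈ K) : F \ σ ∈ K.link σ :=
  mem_link.2 ⟨disjoint_sdiff, by rwa [union_sdiff_self_eq_union]⟩

theorem mem_join : σ ∈ join K L ↔ ∃ a ∈ K, ∃ b ∈ L, a ∪ b = σ := mem_image₂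

theorem mem_boundaryComplex : σ ∈ boundaryComplex F ↔ σ ⊂ F := mem_ssubsets

theorem mem_join_point : σ ∈ join (point v) L ↔ σ.erase v ∈ L := by
  rw [mem_join]
  constructor
  · rintro ⟨a, ha, b, hb, rfl⟩
    refine L.down_closed _ hb _ (subset_insert_iff.1 ?_)
    rw [insert_eq]
    exact union_subset_union_left (mem_powerset.1 ha)
  · intro h
    refine ⟨σ ∩ {v}, mem_powerset.2 inter_subset_right, _, h, ?_⟩
    rw [← sdiff_singleton_eq_erase, union_comm, sdiff_union_inter]

theorem mem_join_boundaryComplex (hG : ∀ τ ∈ L, Disjoint G τ) :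
    σ ∈ join (boundaryComplex G) L ↔ σ \ G ∈ L ∧ ¬G ⊆ σ := by
  rw [mem_join]
  constructor
  · rintro ⟨a, ha, b, hb, rfl⟩
    have haG := mem_boundaryComplex.1 ha
    rw [union_sdiff_distrib, sdiff_eq_empty_iff_subset.2 haG.1, empty_union,
      sdiff_eq_self_of_disjoint (hG b hb).symm]
    exact ⟨hb, fun h => haG.2 ((hG b hb).left_le_of_le_sup_right h)⟩
  · rintro ⟨h, hGσ⟩
    refine ⟨σ ∩ G, mem_boundaryComplex.2 ⟨inter_subset_right, fun h => hGσ ?_⟩, σ \ G, h, ?_⟩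
    · exact h.trans inter_subset_left
    · rw [union_comm, sdiff_union_inter]

theorem mem_join_boundaryComplex_link :
    σ ∈ join (boundaryComplex F) (K.link F) ↔ σ ∪ F ∈ K ∧ ¬F ⊆ σ := by
  rw [mem_join_boundaryComplex fun _ => disjoint_of_mem_link, mem_link, union_sdiff_self_eq_union,
    union_comm, and_iff_right disjoint_sdiff]

theorem join_boundaryComplex_singleton (hg : ∀ τ ∈ L, g ∉ τ) :
    join (boundaryComplex {g}) L = L := by
  refine ext_mem fun σ => ?_
  rw [mem_join_boundaryComplex fun τ hτ => disjoint_singleton_left.2 (hg τ hτ),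
    singleton_subset_iff, sdiff_singleton_eq_erase]
  constructor
  · rintro ⟨h, hgσ⟩
    rwa [erase_eq_of_notMem hgσ] at h
  · intro h
    rw [erase_eq_of_notMem (hg σ h)]
    exact ⟨h, hg σ h⟩

theorem link_join_boundaryComplex_insert (hg : g ∉ G) (hG : ∀ τ ∈ L, Disjoint (insert g G) τ) :
    (join (boundaryComplex (insert g G)) L).link {g} = join (boundaryComplex G) L := by
  have hG' : ∀ τ ∈ L, Disjoint G τ := fun τ hτ => (hG τ hτ).mono_left (subset_insert g G)
  refine ext_mem fun σ => ?_
  rw [mem_link_singleton, mem_join_boundaryComplex hG, mem_join_boundaryComplex hG',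
    insert_subset_insert_iff hg, insert_sdiff_of_mem _ (mem_insert_self g G)]
  have hsdiff (hgσ : g ∉ σ) : σ \ insert g G = σ \ G := by
    rw [sdiff_insert, erase_eq_of_notMem fun h => hgσ (mem_sdiff.1 h).1]
  constructor
  · rintro ⟨hgσ, h⟩
    rwa [hsdiff hgσ] at h
  · intro h
    have hgσ : g ∉ σ := fun hgσ =>
      disjoint_left.1 (hG _ h.1) (mem_insert_self g G) (mem_sdiff.2 ⟨hgσ, hg⟩)
    rw [hsdiff hgσ]
    exact ⟨hgσ, h⟩

end LinkJoin

section Stellar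

variable {V : Type*} [DecidableEq V]

/-- The closed star `F * lk_K(F)` of `F`, which is void when `F` is not a face. -/
def star (K : SimpComplex V) (F : Finset V) : SimpComplex V where
  faces := {τ ∈ K.faces | τ ∪ F ∈ K.faces}
  down_closed := by
    intro σ hσ τ hτσ
    rw [mem_filter] at hσ ⊢
    exact ⟨K.down_closed σ hσ.1 τ hτσ, K.down_closed _ hσ.2 _ (union_subset_union_left hτσ)⟩

/-- The complex `K ∪ {v} * F * lk_K(F)`, obtained by attaching to `K` a cone over the closed star
of `F`. Both `K` and its stellar subdivision at `F` are subcomplexes of it. -/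
def coneOverStar (K : SimpComplex V) (F : Finset V) (v : V) : SimpComplex V where
  faces := K.faces ∪ (join (point v) (K.star F)).faces
  down_closed := by
    intro σ hσ τ hτσ
    rw [mem_union] at hσ ⊢
    exact hσ.imp (K.down_closed σ · τ hτσ) (SimpComplex.down_closed _ σ · τ hτσ)

variable {K : SimpComplex V} {F M T σ τ : Finset V} {v : V}

theorem mem_star : τ ∈ K.star F ↔ τ ∪ F ∈ K :=
  mem_filter.trans
    ⟨fun h => h.2, fun h => ⟨K.down_closed _ h _ subset_union_left, h⟩⟩

theorem mem_coneOverStar : σ ∈ K.coneOverStar F v ↔ σ ∈ K ∨ σ.erase v ∪ F ∈ K :=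
  mem_union.trans (or_congr Iff.rfl (mem_join_point.trans mem_star))

theorem mem_stellar (hF : F ∈ K) (hv : {v} ∉ K) :
    σ ∈ K.stellar F v ↔ (σ ∈ K ∨ σ.erase v ∪ F ∈ K) ∧ ¬F ⊆ σ := by
  have hcone : σ ∈ join (point v) (join (boundaryComplex F) (K.link F)) ↔
      σ.erase v ∪ F ∈ K ∧ ¬F ⊆ σ := by
    rw [mem_join_point, mem_join_boundaryComplex_link, subset_erase,
      and_iff_left (notMem_of_singleton_notMem hv hF)]
  rw [or_and_right, ← hcone]
  exact mem_union.trans (or_congr_left mem_filter)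

theorem mem_stellar_of_notMem (hF : F ∈ K) (hv : {v} ∉ K) (hvσ : v ∉ σ) :
    σ ∈ K.stellar F v ↔ σ ∈ K ∧ ¬F ⊆ σ := by
  have hunion : σ ∪ F ∈ K → σ ∈ K := fun h => K.down_closed _ h _ subset_union_left
  rw [mem_stellar hF hv, erase_eq_of_notMem hvσ, or_iff_left_of_imp hunion]

theorem insert_mem_stellar (hF : F ∈ K) (hv : {v} ∉ K) (hvσ : v ∉ σ) :
    insert v σ ∈ K.stellar F v ↔ σ ∪ F ∈ K ∧ ¬F ⊆ σ := by
  rw [mem_stellar hF hv, erase_insert hvσ,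
    subset_insert_iff_of_notMem (notMem_of_singleton_notMem hv hF),
    or_iff_right fun h => notMem_of_singleton_notMem hv h (mem_insert_self v σ)]

theorem link_stellar_of_union_notMem (hF : F ∈ K) (hv : {v} ∉ K) (hT : T ∪ F ∉ K) (hvT : v ∉ T) :
    (K.stellar F v).link T = K.link T := by
  refine ext_mem fun σ => ?_
  rw [mem_link, mem_link, mem_stellar hF hv]
  refine and_congr_right fun _ => ⟨?_, fun h => ⟨Or.inl h, fun hFσ => hT ?_⟩⟩
  · rintro ⟨h | h, -⟩
    · exact h
    · refine absurd (K.down_closed _ h _ (union_subset_union_left ?_)) hT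
      exact subset_erase.2 ⟨subset_union_left, hvT⟩
  · exact K.down_closed _ h _ (union_subset subset_union_left hFσ)

theorem link_stellar_of_union_mem (hF : F ∈ K) (hv : {v} ∉ K) (hT : T ∪ F ∈ K) :
    (K.stellar F v).link T = (K.link T).stellar (F \ T) v := by
  have hvT : v ∉ T := fun h => notMem_of_singleton_notMem hv hT (mem_union_left F h)
  refine ext_mem fun σ => ?_
  have hsubset : F \ T ⊆ σ ↔ F ⊆ T ∪ σ := sdiff_le_iff
  have hunion : T ∪ (σ.erase v ∪ F \ T) = (T ∪ σ).erase v ∪ F := by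
    rw [erase_union_distrib, erase_eq_of_notMem hvT, union_left_comm, union_sdiff_self_eq_union,
      union_left_comm, ← union_assoc]
  have hdisjoint : Disjoint T (σ.erase v ∪ F \ T) ↔ Disjoint T σ := by
    rw [disjoint_union_right, and_iff_left disjoint_sdiff, ← disjoint_erase_comm,
      erase_eq_of_notMem hvT]
  rw [mem_link, mem_stellar hF hv, mem_stellar (sdiff_mem_link hT) (singleton_notMem_link hv T),
    mem_link, mem_link, hsubset, hunion, hdisjoint, ← and_or_left, and_assoc]

theorem link_stellar_singleton (hF : F ∈ K) (hv : {v} ∉ K) :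
    (K.stellar F v).link {v} = join (boundaryComplex F) (K.link F) := by
  refine ext_mem fun σ => ?_
  rw [mem_link_singleton, mem_join_boundaryComplex_link]
  constructor
  · rintro ⟨hvσ, h⟩
    exact (insert_mem_stellar hF hv hvσ).1 h
  · intro h
    have hvσ : v ∉ σ := fun hvσ => notMem_of_singleton_notMem hv h.1 (mem_union_left F hvσ)
    exact ⟨hvσ, (insert_mem_stellar hF hv hvσ).2 h⟩

theorem link_stellar_insert (hF : F ∈ K) (hv : {v} ∉ K) (hT : T ∪ F ∈ K) :
    (K.stellar F v).link (insert v T) = join (boundaryComplex (F \ T)) (K.link (T ∪ F)) := by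
  have hvT : v ∉ T := fun h => notMem_of_singleton_notMem hv hT (mem_union_left F h)
  rw [insert_eq, union_comm, ← link_link (disjoint_singleton_right.2 hvT),
    link_stellar_of_union_mem hF hv hT,
    link_stellar_singleton (sdiff_mem_link hT) (singleton_notMem_link hv T),
    link_link disjoint_sdiff, union_sdiff_self_eq_union]

theorem card_le_size_of_mem_stellar (hF : F ∈ K) (hv : {v} ∉ K) (hσ : σ ∈ K.stellar F v) :
    #σ ≤ K.size := by
  obtain ⟨hσK | hσK, hFσ⟩ := (mem_stellar hF hv).1 hσ
  · exact card_le_size hσK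
  · have hlt : #(σ.erase v) < #(σ.erase v ∪ F) := card_lt_card
      ⟨subset_union_left, fun h => hFσ ((subset_union_right.trans h).trans (erase_subset v σ))⟩
    calc #σ ≤ #(σ.erase v) + 1 := Nat.sub_le_iff_le_add.1 pred_card_le_card_erase
      _ ≤ #(σ.erase v ∪ F) := hlt
      _ ≤ K.size := card_le_size hσK

theorem exists_mem_stellar_card_eq (hF : F ∈ K) (hF0 : F.Nonempty) (hv : {v} ∉ K) (hτ : τ ∈ K) :
    ∃ σ ∈ K.stellar F v, #σ = #τ := by
  have hvτ := notMem_of_singleton_notMem hv hτ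
  by_cases hFτ : F ⊆ τ
  · obtain ⟨f, hf⟩ := hF0
    have hvf : v ∉ τ.erase f := fun h => hvτ (mem_of_mem_erase h)
    refine ⟨insert v (τ.erase f), (insert_mem_stellar hF hv hvf).2 ⟨?_, fun h => ?_⟩, ?_⟩
    · exact K.down_closed _ hτ _ (union_subset (erase_subset f τ) hFτ)
    · exact notMem_erase f τ (h hf)
    · rw [card_insert_of_notMem hvf, card_erase_add_one (hFτ hf)]
  · exact ⟨τ, (mem_stellar_of_notMem hF hv hvτ).2 ⟨hτ, hFτ⟩, rfl⟩

theorem size_stellar (hF : F ∈ K) (hF0 : F.Nonempty) (hv : {v} ∉ K) :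
    (K.stellar F v).size = K.size := by
  refine le_antisymm (Finset.sup_le fun _ => card_le_size_of_mem_stellar hF hv) ?_
  obtain ⟨τ, hτ, hτsize⟩ := exists_mem_card_eq_size ⟨F, hF⟩
  obtain ⟨σ, hσ, hστ⟩ := exists_mem_stellar_card_eq hF hF0 hv hτ
  rw [← hτsize, ← hστ]
  exact card_le_size hσ

end Stellar

section MissingFaces

variable {V : Type*} [DecidableEq V] {K : SimpComplex V} {F M : Finset V} {v : V}

theorem exists_isMissingFace_superset (hM : M ∪ F ∉ K) (hτ : ∀ τ, τ ⊂ M → τ ∪ F ∈ K) :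
    ∃ N, M ⊆ N ∧ K.IsMissingFace N := by
  obtain ⟨N, hNMF, hN⟩ := exists_isMissingFace_subset hM
  refine ⟨N, ?_, hN⟩
  by_contra hMN
  refine hN.1 (K.down_closed _ (hτ (M ∩ N) ⟨inter_subset_left, fun h => hMN ?_⟩) _ ?_)
  · exact h.trans inter_subset_right
  · rw [inter_union_distrib_right]
    exact subset_inter hNMF subset_union_left

theorem IsMissingFace.exists_superset_of_link (hM : (K.link F).IsMissingFace M) (hcard : 1 < #M) :
    ∃ N, M ⊆ N ∧ K.IsMissingFace N := by
  have hdisjoint : Disjoint F M := by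
    refine disjoint_right.2 fun x hx =>
      disjoint_singleton_right.1 (disjoint_of_mem_link (K := K) ?_)
    refine hM.2 _ ((singleton_subset_iff.2 hx).ssubset_of_ne fun h => hcard.ne ?_)
    rw [← h, card_singleton]
  refine exists_isMissingFace_superset (F := F) (fun h => hM.1 (mem_link.2 ⟨hdisjoint, ?_⟩))
    fun τ hτ => ?_
  · rwa [union_comm]
  · rw [union_comm]
    exact (mem_link.1 (hM.2 τ hτ)).2

theorem IsMissingFace.exists_card_le_of_stellar_of_mem (hF : F ∈ K) (hv : {v} ∉ K)
    (hM : (K.stellar F v).IsMissingFace M) (hvM : v ∈ M) :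
    ∃ N, #M ≤ #N ∧ K.IsMissingFace N := by
  obtain ⟨T, hvT, rfl⟩ : ∃ T, v ∉ T ∧ insert v T = M :=
    ⟨M.erase v, notMem_erase v M, insert_erase hvM⟩
  obtain ⟨hTK, hFT⟩ := (mem_stellar_of_notMem hF hv hvT).1 (hM.2 T (ssubset_insert hvT))
  have hTF : T ∪ F ∉ K := fun h => hM.1 ((insert_mem_stellar hF hv hvT).2 ⟨h, hFT⟩)
  obtain ⟨N, hTN, hN⟩ := exists_isMissingFace_superset hTF fun τ hτ => by
    have hvτ : v ∉ τ := fun h => hvT (hτ.1 h)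
    have hinsert : insert v τ ⊂ insert v T :=
      ⟨insert_subset_insert v hτ.1, fun h => hτ.2 ((insert_subset_insert_iff hvT).1 h)⟩
    exact ((insert_mem_stellar hF hv hvτ).1 (hM.2 _ hinsert)).1
  refine ⟨N, ?_, hN⟩
  rw [card_insert_of_notMem hvT]
  exact card_lt_card (hTN.ssubset_of_ne fun h => hN.1 (h ▸ hTK))

theorem IsMissingFace.eq_or_of_stellar_of_notMem (hF : F ∈ K) (hv : {v} ∉ K)
    (hM : (K.stellar F v).IsMissingFace M) (hvM : v ∉ M) : M = F ∨ K.IsMissingFace M := by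
  have hproper : ∀ τ, τ ⊂ M → τ ∈ K ∧ ¬F ⊆ τ := fun τ hτ =>
    (mem_stellar_of_notMem hF hv fun h => hvM (hτ.1 h)).1 (hM.2 τ hτ)
  by_cases hMK : M ∈ K
  · have hFM : F ⊆ M := by
      by_contra h
      exact hM.1 ((mem_stellar_of_notMem hF hv hvM).2 ⟨hMK, h⟩)
    refine Or.inl (by_contra fun hne => ?_)
    exact (hproper F (hFM.ssubset_of_ne (Ne.symm hne))).2 subset_rfl
  · exact Or.inr ⟨hMK, fun τ hτ => (hproper τ hτ).1⟩

end MissingFaces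

section Chains

theorem map_mem_of_mem_supported {α R M : Type*} [Semiring R] [AddCommMonoid M] [Module R M]
    {s : Set α} {p : Submodule R M} (f : (α →₀ R) →ₗ[R] M)
    (h : ∀ a ∈ s, ∀ r : R, f (Finsupp.single a r) ∈ p) {c : α →₀ R}
    (hc : c ∈ Finsupp.supported R R s) : f c ∈ p := by
  rw [← Finsupp.sum_single c, Finsupp.sum, map_sum]
  exact Submodule.sum_mem _ fun a ha => h a (hc ha) _

variable {V : Type*} [LinearOrder V] (R : Type*) [CommRing R]

/-- The sign with which `σ \ {v}` occurs in the boundary of `σ`. It is also used for `v ∉ σ`, where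
it is the sign that sorts `v` into `σ`. -/
def vertexSign (σ : Finset V) (v : V) : R := (-1 : R) ^ #{w ∈ σ | w < v}

/-- The wedge operator `σ ↦ x ∧ σ`, which is `0` on the simplices that contain `x`. -/
noncomputable def wedge (x : V) : (Finset V →₀ R) →ₗ[R] (Finset V →₀ R) :=
  Finsupp.linearCombination R fun σ : Finset V =>
    if x ∈ σ then 0 else Finsupp.single (insert x σ) (vertexSign R σ x)

/-- The contraction `x ∧ σ ↦ σ`, which is `0` on the simplices that do not contain `x`. -/
noncomputable def contract (x : V) : (Finset V →₀ R) →ₗ[R] (Finset V →₀ R) :=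
  Finsupp.linearCombination R fun σ : Finset V =>
    if x ∈ σ then Finsupp.single (σ.erase x) (vertexSign R σ x) else 0

theorem vertexSign_mul_self (σ : Finset V) (v : V) :
    vertexSign R σ v * vertexSign R σ v = 1 := by
  rw [vertexSign, ← mul_pow, neg_one_mul, neg_neg, one_pow]

theorem vertexSign_insert_self (σ : Finset V) (v : V) :
    vertexSign R (insert v σ) v = vertexSign R σ v := by
  simp [vertexSign, filter_insert]

theorem vertexSign_erase_self {σ : Finset V} {v : V} (hv : v ∈ σ) :
    vertexSign R (σ.erase v) v = vertexSign R σ v := by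
  rw [← vertexSign_insert_self, insert_erase hv]

theorem vertexSign_insert {σ : Finset V} {x : V} (hx : x ∉ σ) (v : V) :
    vertexSign R (insert x σ) v = (if x < v then -1 else 1) * vertexSign R σ v := by
  rw [vertexSign, vertexSign, filter_insert]
  split_ifs with h
  · rw [card_insert_of_notMem (by simp [hx]), pow_succ']
  · rw [one_mul]

theorem vertexSign_insert_mul_vertexSign {σ : Finset V} {x v : V} (hx : x ∉ σ) (hv : v ∈ σ) :
    vertexSign R (insert x σ) v * vertexSign R σ x =
      -(vertexSign R σ v * vertexSign R (σ.erase v) x) := by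
  have hσ : vertexSign R σ x = (if v < x then -1 else 1) * vertexSign R (σ.erase v) x := by
    rw [← vertexSign_insert R (notMem_erase v σ), insert_erase hv]
  rw [vertexSign_insert R hx, hσ]
  rcases lt_or_gt_of_ne (ne_of_mem_of_not_mem hv hx) with h | h
  · rw [if_neg h.not_gt, if_pos h]; ring
  · rw [if_pos h, if_neg h.not_gt]; ring

variable {R} {x : V} {σ : Finset V} {s t : Set (Finset V)} {c : Finset V →₀ R}

theorem boundaryMap_single (σ : Finset V) (r : R) : boundaryMap R (Finsupp.single σ r) =
    ∑ v ∈ σ, Finsupp.single (σ.erase v) (r * vertexSign R σ v) := by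
  simp [boundaryMap, vertexSign, smul_sum]

theorem wedge_single_of_mem (h : x ∈ σ) (r : R) : wedge R x (Finsupp.single σ r) = 0 := by
  simp [wedge, h]

theorem wedge_single_of_notMem (h : x ∉ σ) (r : R) :
    wedge R x (Finsupp.single σ r) = Finsupp.single (insert x σ) (r * vertexSign R σ x) := by
  simp [wedge, h]

theorem contract_single_of_mem (h : x ∈ σ) (r : R) :
    contract R x (Finsupp.single σ r) = Finsupp.single (σ.erase x) (r * vertexSign R σ x) := by
  simp [contract, h]

theorem contract_single_of_notMem (h : x ∉ σ) (r : R) :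
    contract R x (Finsupp.single σ r) = 0 := by
  simp [contract, h]

theorem wedge_contract_single_of_mem (h : x ∈ σ) (r : R) :
    wedge R x (contract R x (Finsupp.single σ r)) = Finsupp.single σ r := by
  rw [contract_single_of_mem h, wedge_single_of_notMem (notMem_erase x σ), insert_erase h,
    vertexSign_erase_self R h, mul_assoc, vertexSign_mul_self, mul_one]

theorem contract_wedge_single_of_notMem (h : x ∉ σ) (r : R) :
    contract R x (wedge R x (Finsupp.single σ r)) = Finsupp.single σ r := by
  rw [wedge_single_of_notMem h, contract_single_of_mem (mem_insert_self x σ), erase_insert h,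
    vertexSign_insert_self, mul_assoc, vertexSign_mul_self, mul_one]

theorem boundaryMap_mem_supported (h : ∀ σ ∈ s, ∀ v ∈ σ, σ.erase v ∈ t)
    (hc : c ∈ Finsupp.supported R R s) : boundaryMap R c ∈ Finsupp.supported R R t := by
  refine map_mem_of_mem_supported _ (fun σ hσ r => ?_) hc
  rw [boundaryMap_single]
  exact Submodule.sum_mem _ fun v hv => Finsupp.single_mem_supported R _ (h σ hσ v hv)

theorem wedge_mem_supported (h : ∀ σ ∈ s, x ∉ σ → insert x σ ∈ t)
    (hc : c ∈ Finsupp.supported R R s) : wedge R x c ∈ Finsupp.supported R R t := by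
  refine map_mem_of_mem_supported _ (fun σ hσ r => ?_) hc
  by_cases hx : x ∈ σ
  · rw [wedge_single_of_mem hx]
    exact Submodule.zero_mem _
  · rw [wedge_single_of_notMem hx]
    exact Finsupp.single_mem_supported R _ (h σ hσ hx)

theorem contract_mem_supported (h : ∀ σ ∈ s, x ∈ σ → σ.erase x ∈ t)
    (hc : c ∈ Finsupp.supported R R s) : contract R x c ∈ Finsupp.supported R R t := by
  refine map_mem_of_mem_supported _ (fun σ hσ r => ?_) hc
  by_cases hx : x ∈ σ
  · rw [contract_single_of_mem hx]
    exact Finsupp.single_mem_supported R _ (h σ hσ hx)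
  · rw [contract_single_of_notMem hx]
    exact Submodule.zero_mem _

theorem contract_eq_zero (h : ∀ σ ∈ s, x ∉ σ) (hc : c ∈ Finsupp.supported R R s) :
    contract R x c = 0 := by
  rw [← Submodule.mem_bot R]
  exact map_mem_of_mem_supported _ (fun σ hσ => contract_single_of_notMem (h σ hσ)) hc

theorem contract_wedge (h : ∀ σ ∈ s, x ∉ σ) (hc : c ∈ Finsupp.supported R R s) :
    contract R x (wedge R x c) = c := by
  rw [← sub_eq_zero, ← Submodule.mem_bot R]
  refine map_mem_of_mem_supported (contract R x ∘ₗ wedge R x - LinearMap.id)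
    (fun σ hσ r => ?_) hc
  exact sub_eq_zero.2 (contract_wedge_single_of_notMem (h σ hσ) r)

theorem sub_wedge_contract_mem_supported (x : V) (hc : c ∈ Finsupp.supported R R s) :
    c - wedge R x (contract R x c) ∈ Finsupp.supported R R {σ | σ ∈ s ∧ x ∉ σ} := by
  refine map_mem_of_mem_supported (LinearMap.id - wedge R x ∘ₗ contract R x)
    (fun σ hσ r => ?_) hc
  rw [LinearMap.sub_apply, LinearMap.id_apply, LinearMap.comp_apply]
  by_cases hx : x ∈ σ
  · rw [wedge_contract_single_of_mem hx, sub_self]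
    exact Submodule.zero_mem _
  · rw [contract_single_of_notMem hx, map_zero, sub_zero]
    exact Finsupp.single_mem_supported R _ ⟨hσ, hx⟩

theorem mem_supported_of_contract_eq_zero (hc : c ∈ Finsupp.supported R R s)
    (h : contract R x c = 0) : c ∈ Finsupp.supported R R {σ | σ ∈ s ∧ x ∉ σ} := by
  simpa only [h, map_zero, sub_zero] using sub_wedge_contract_mem_supported x hc

theorem boundaryMap_wedge (x : V) (c : Finset V →₀ R) :
    boundaryMap R (wedge R x c) = c - wedge R x (boundaryMap R c) := by
  rw [eq_sub_iff_add_eq]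
  induction c using Finsupp.induction_linear with
  | zero => simp only [map_zero, add_zero]
  | add c e hc he =>
    simp only [map_add]
    rw [add_add_add_comm, hc, he]
  | single σ r =>
    rw [boundaryMap_single, map_sum]
    by_cases hx : x ∈ σ
    · rw [wedge_single_of_mem hx, map_zero, zero_add, sum_eq_single_of_mem x hx fun v _ hv =>
        wedge_single_of_mem (mem_erase.2 ⟨hv.symm, hx⟩) _]
      rw [← contract_single_of_mem hx, wedge_contract_single_of_mem hx]
    · rw [wedge_single_of_notMem hx, boundaryMap_single, sum_insert hx, erase_insert hx,
        vertexSign_insert_self, mul_assoc, vertexSign_mul_self, mul_one, add_assoc,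
        ← sum_add_distrib, sum_eq_zero, add_zero]
      intro v hv
      have hvx : v ≠ x := ne_of_mem_of_not_mem hv hx
      rw [wedge_single_of_notMem (fun h => hx (mem_of_mem_erase h)),
        erase_insert_of_ne hvx.symm, ← Finsupp.single_add, Finsupp.single_eq_zero, mul_assoc,
        mul_comm (vertexSign R σ x), vertexSign_insert_mul_vertexSign R hx hv]
      ring

theorem boundaryMap_boundaryMap (c : Finset V →₀ R) : boundaryMap R (boundaryMap R c) = 0 := by
  induction c using Finsupp.induction_linear with
  | zero => simp only [map_zero]
  | add c e hc he => simp only [map_add, hc, he, add_zero]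
  | single σ r =>
    induction σ using Finset.induction_on generalizing r with
    | empty => simp [boundaryMap_single]
    | insert x σ hx ih =>
      rw [← wedge_contract_single_of_mem (mem_insert_self x σ),
        contract_single_of_mem (mem_insert_self x σ), erase_insert hx, boundaryMap_wedge, map_sub,
        boundaryMap_wedge, ih, map_zero, sub_zero, sub_self]

-- Decompose `c = c' + x ∧ b` with `b = contract x c`, where `c'` and `b` avoid `x`: then
-- `∂ c = ∂ c' + b - x ∧ ∂ b`, whose contraction is `-∂ b`.
theorem boundaryMap_contract (x : V) (c : Finset V →₀ R) :
    boundaryMap R (contract R x c) = -contract R x (boundaryMap R c) := by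
  set b := contract R x c
  set c' := c - wedge R x b with hc'
  have hc : c ∈ Finsupp.supported R R Set.univ := Set.subset_univ _
  have havoid : ∀ σ ∈ {σ : Finset V | x ∉ σ}, ∀ v ∈ σ, σ.erase v ∈ {σ : Finset V | x ∉ σ} :=
    fun σ hσ v _ h => hσ (mem_of_mem_erase h)
  have hc'_avoid : c' ∈ Finsupp.supported R R {σ | x ∉ σ} :=
    Finsupp.supported_mono (fun _ h => h.2) (sub_wedge_contract_mem_supported x hc)
  have hb_avoid : b ∈ Finsupp.supported R R {σ | x ∉ σ} :=
    contract_mem_supported (fun σ _ _ => notMem_erase x σ) hc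
  have hboundary : boundaryMap R c = boundaryMap R c' + (b - wedge R x (boundaryMap R b)) := by
    rw [← boundaryMap_wedge, ← map_add, hc', sub_add_cancel]
  rw [hboundary, map_add, map_sub (contract R x) b,
    contract_eq_zero (fun _ h => h) (boundaryMap_mem_supported havoid hc'_avoid),
    contract_eq_zero (fun _ h => h) hb_avoid,
    contract_wedge (fun _ h => h) (boundaryMap_mem_supported havoid hb_avoid), zero_add, zero_sub,
    neg_neg]

end Chains

section Homology

theorem nonempty_map_mkQ_equiv {R M N : Type*} [Ring R] [AddCommGroup M] [Module R M]
    [AddCommGroup N] [Module R N] {Z B : Submodule R M} {Z' B' : Submodule R N} (f : M →ₗ[R] N)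
    (hZ : ∀ z ∈ Z, f z ∈ Z') (hB : ∀ b ∈ B, f b ∈ B')
    (hinj : ∀ z ∈ Z, f z ∈ B' → z ∈ B) (hsurj : ∀ z' ∈ Z', ∃ z ∈ Z, f z - z' ∈ B') :
    Nonempty (Z.map B.mkQ ≃ₗ[R] Z'.map B'.mkQ) := by
  have hmap : ∀ y ∈ Z.map B.mkQ, B.mapQ B' f hB y ∈ Z'.map B'.mkQ := by
    rintro _ ⟨z, hz, rfl⟩
    exact ⟨f z, hZ z hz, rfl⟩
  refine ⟨LinearEquiv.ofBijective ((B.mapQ B' f hB).restrict hmap) ⟨?_, ?_⟩⟩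
  · rw [← LinearMap.ker_eq_bot, LinearMap.ker_eq_bot']
    rintro ⟨_, z, hz, rfl⟩ h
    have hfz : B'.mkQ (f z) = 0 := congrArg Subtype.val h
    rw [Submodule.mkQ_apply, Submodule.Quotient.mk_eq_zero] at hfz
    exact Subtype.ext ((Submodule.Quotient.mk_eq_zero B).2 (hinj z hz hfz))
  · rintro ⟨_, z', hz', rfl⟩
    obtain ⟨z, hz, h⟩ := hsurj z' hz'
    exact ⟨⟨B.mkQ z, z, hz, rfl⟩, Subtype.ext ((Submodule.Quotient.eq B').2 h)⟩

variable {V : Type*} [LinearOrder V] {R : Type*} [CommRing R]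
  {K L W X : SimpComplex V} {m : ℕ} {c : Finset V →₀ R}

theorem mem_cycles : c ∈ K.cycles R m ↔ c ∈ K.chains R m ∧ boundaryMap R c = 0 := Iff.rfl

theorem mem_boundaries :
    c ∈ K.boundaries R m ↔ ∃ e ∈ K.chains R (m + 1), boundaryMap R e = c := Iff.rfl

theorem chains_le_supported {V : Type*} (R : Type*) [CommRing R] (K : SimpComplex V) (m : ℕ) :
    K.chains R m ≤ Finsupp.supported R R {σ | σ ∈ K} :=
  Finsupp.supported_mono fun _ h => h.1

theorem chains_eq_bot {V : Type*} {R : Type*} [CommRing R] {K : SimpComplex V} {m : ℕ}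
    (h : ∀ σ ∈ K, #σ ≠ m) : K.chains R m = ⊥ := by
  have hempty : {σ | σ ∈ K ∧ #σ = m} = ∅ :=
    Set.eq_empty_of_forall_notMem fun σ hσ => h σ hσ.1 hσ.2
  rw [chains, hempty, Finsupp.supported_empty]

theorem boundaryMap_mem_chains (hc : c ∈ K.chains R (m + 1)) : boundaryMap R c ∈ K.chains R m :=
  boundaryMap_mem_supported (fun σ hσ v hv => ⟨K.down_closed _ hσ.1 _ (erase_subset v σ), by
    rw [card_erase_of_mem hv, hσ.2, Nat.add_sub_cancel]⟩) hc

theorem boundaries_le_cycles (R : Type*) [CommRing R] (K : SimpComplex V) (m : ℕ) :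
    K.boundaries R m ≤ K.cycles R m := by
  rintro _ ⟨c, hc, rfl⟩
  exact ⟨boundaryMap_mem_chains hc, boundaryMap_boundaryMap c⟩

theorem subsingleton_reducedHomology_of_le (h : K.cycles R m ≤ K.boundaries R m) :
    Subsingleton (K.reducedHomology R m) := by
  rw [Submodule.subsingleton_iff_eq_bot, reducedHomology, eq_bot_iff, Submodule.map_le_iff_le_comap,
    Submodule.comap_bot, Submodule.ker_mkQ]
  exact h

-- The faces of `W` outside `L` come in pairs `σ`, `insert x σ`: if `c₁` is the part of `c` on them,
-- subtracting `∂ (x ∧ c₁)` from `c` replaces `c₁` by `x ∧ ∂ c₁`, which lies in `L`.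
theorem exists_sub_boundaryMap_mem_chains {x : V}
    (htoggle : ∀ σ, x ∉ σ → ((σ ∈ W ∧ σ ∉ L) ↔ (insert x σ ∈ W ∧ insert x σ ∉ L)))
    (hc : c ∈ W.chains R m) (hb : boundaryMap R c ∈ Finsupp.supported R R {σ | σ ∈ L}) :
    ∃ e ∈ W.chains R (m + 1), c - boundaryMap R e ∈ L.chains R m := by
  have hsplit : W.chains R m ≤
      L.chains R m ⊔ Finsupp.supported R R {σ | (σ ∈ W ∧ σ ∉ L) ∧ #σ = m} := by
    rw [chains, chains, ← Finsupp.supported_union]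
    refine Finsupp.supported_mono fun σ hσ => ?_
    by_cases hσL : σ ∈ L
    · exact Or.inl ⟨hσL, hσ.2⟩
    · exact Or.inr ⟨⟨hσ.1, hσL⟩, hσ.2⟩
  obtain ⟨c₀, hc₀, c₁, hc₁, rfl⟩ := Submodule.mem_sup.1 (hsplit hc)
  have hwedge : wedge R x c₁ ∈ W.chains R (m + 1) :=
    wedge_mem_supported (fun σ hσ hx =>
      ⟨((htoggle σ hx).1 hσ.1).1, by rw [card_insert_of_notMem hx, hσ.2]⟩) hc₁
  have hboundary : boundaryMap R c₁ ∈ Finsupp.supported R R {σ | σ ∈ L} := by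
    rw [← add_sub_cancel_left (boundaryMap R c₀) (boundaryMap R c₁), ← map_add]
    exact Submodule.sub_mem _ hb (boundaryMap_mem_supported
      (fun σ hσ v _ => L.down_closed σ hσ.1 _ (erase_subset v σ)) hc₀)
  have hL : wedge R x (boundaryMap R c₁) ∈ L.chains R m := by
    have hW : wedge R x (boundaryMap R c₁) ∈ W.chains R m := by
      rw [← sub_sub_cancel c₁ (wedge R x (boundaryMap R c₁)), ← boundaryMap_wedge]
      exact Submodule.sub_mem _ (fun σ hσ => ⟨(hc₁ hσ).1.1, (hc₁ hσ).2⟩)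
        (boundaryMap_mem_chains hwedge)
    have hnotMem : wedge R x (boundaryMap R c₁) ∈
        Finsupp.supported R R {σ | ¬(σ ∈ W ∧ σ ∉ L)} :=
      wedge_mem_supported (fun σ hσ hx h => ((htoggle σ hx).2 h).2 hσ) hboundary
    exact fun σ hσ => ⟨not_not.1 fun h => hnotMem hσ ⟨(hW hσ).1, h⟩, (hW hσ).2⟩
  refine ⟨wedge R x c₁, hwedge, ?_⟩
  rw [boundaryMap_wedge, add_comm c₀, add_sub_sub_cancel]
  exact Submodule.add_mem _ hc₀ hL

theorem nonempty_reducedHomology_equiv_of_toggle (R : Type*) [CommRing R] (x : V)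
    (hLW : ∀ σ ∈ L, σ ∈ W)
    (htoggle : ∀ σ, x ∉ σ → ((σ ∈ W ∧ σ ∉ L) ↔ (insert x σ ∈ W ∧ insert x σ ∉ L))) (m : ℕ) :
    Nonempty (L.reducedHomology R m ≃ₗ[R] W.reducedHomology R m) := by
  have hchains (n : ℕ) : L.chains R n ≤ W.chains R n :=
    Finsupp.supported_mono fun σ h => ⟨hLW σ h.1, h.2⟩
  refine nonempty_map_mkQ_equiv LinearMap.id (fun z hz => ⟨hchains m hz.1, hz.2⟩) ?_ ?_ ?_
  · rintro _ ⟨c, hc, rfl⟩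
    exact ⟨c, hchains _ hc, rfl⟩
  · rintro _ hz ⟨b, hb, rfl⟩
    obtain ⟨e, -, he⟩ := exists_sub_boundaryMap_mem_chains htoggle hb
      (chains_le_supported R L m hz.1)
    exact ⟨_, he, by rw [map_sub, boundaryMap_boundaryMap, sub_zero]⟩
  · intro z hz
    obtain ⟨hzW, hz0⟩ := mem_cycles.1 hz
    obtain ⟨e, he, hze⟩ := exists_sub_boundaryMap_mem_chains htoggle hzW
      (by rw [hz0]; exact Submodule.zero_mem _)
    refine ⟨_, mem_cycles.2 ⟨hze, ?_⟩, mem_boundaries.2 ⟨-e, Submodule.neg_mem _ he, ?_⟩⟩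
    · rw [map_sub, hz0, boundaryMap_boundaryMap, sub_zero]
    · rw [map_neg, LinearMap.id_apply, sub_sub_cancel_left]

section Cone

variable {g y : V}

theorem wedge_mem_supported_of_cone (hyg : y ≠ g)
    (hcone : ∀ σ ∈ X, g ∉ σ → insert y σ ∈ X)
    (hc : c ∈ Finsupp.supported R R {σ | (σ ∈ X ∧ #σ = m) ∧ g ∉ σ}) :
    wedge R y c ∈ Finsupp.supported R R {σ | (σ ∈ X ∧ #σ = m + 1) ∧ g ∉ σ} := by
  refine wedge_mem_supported (fun σ hσ hy => ⟨⟨hcone σ hσ.1.1 hσ.2, ?_⟩, ?_⟩) hc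
  · rw [card_insert_of_notMem hy, hσ.1.2]
  · rw [mem_insert, not_or]
    exact ⟨hyg.symm, hσ.2⟩

theorem mem_boundaries_of_cone (hyg : y ≠ g) (hcone : ∀ σ ∈ X, g ∉ σ → insert y σ ∈ X)
    (hc : c ∈ Finsupp.supported R R {σ | (σ ∈ X ∧ #σ = m) ∧ g ∉ σ})
    (hc0 : boundaryMap R c = 0) : c ∈ X.boundaries R m := by
  refine ⟨wedge R y c, fun σ hσ => (wedge_mem_supported_of_cone hyg hcone hc hσ).1, ?_⟩
  rw [boundaryMap_wedge, hc0, map_zero, sub_zero]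

theorem subsingleton_reducedHomology_zero_of_cone (R : Type*) [CommRing R] (hyg : y ≠ g)
    (hcone : ∀ σ ∈ X, g ∉ σ → insert y σ ∈ X) : Subsingleton (X.reducedHomology R 0) := by
  refine subsingleton_reducedHomology_of_le fun z hz =>
    mem_boundaries_of_cone hyg hcone (fun σ hσ => ⟨hz.1 hσ, ?_⟩) hz.2
  rw [card_eq_zero.1 (hz.1 hσ).2]
  exact notMem_empty g

end Cone

theorem contract_mem_chains_link (g : V) (hc : c ∈ X.chains R (m + 1)) :
    contract R g c ∈ (X.link {g}).chains R m := by
  refine contract_mem_supported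
    (fun σ hσ hg => ⟨mem_link_singleton.2 ⟨notMem_erase g σ, ?_⟩, ?_⟩) hc
  · rw [insert_erase hg]
    exact hσ.1
  · rw [card_erase_of_mem hg, hσ.2, Nat.add_sub_cancel]

theorem wedge_mem_chains_of_mem_chains_link {g : V} (hc : c ∈ (X.link {g}).chains R m) :
    wedge R g c ∈ X.chains R (m + 1) :=
  wedge_mem_supported (fun σ hσ hg => ⟨(mem_link_singleton.1 hσ.1).2, by
    rw [card_insert_of_notMem hg, hσ.2]⟩) hc

theorem contract_wedge_of_mem_chains_link {g : V} (hc : c ∈ (X.link {g}).chains R m) :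
    contract R g (wedge R g c) = c :=
  contract_wedge (fun _ hσ => (mem_link_singleton.1 hσ.1).1) hc

theorem mem_boundaries_of_contract_eq_boundaryMap {g y : V} (hyg : y ≠ g)
    (hcone : ∀ σ ∈ X, g ∉ σ → insert y σ ∈ X) {z b : Finset V →₀ R}
    (hz : z ∈ X.cycles R m) (hb : b ∈ (X.link {g}).chains R m)
    (hbz : boundaryMap R b = contract R g z) : z ∈ X.boundaries R m := by
  obtain ⟨hzX, hz0⟩ := mem_cycles.1 hz
  have hwedge : wedge R g b ∈ X.chains R (m + 1) := wedge_mem_chains_of_mem_chains_link hb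
  have hcontract : contract R g (z + boundaryMap R (wedge R g b)) = 0 := by
    rw [map_add, ← neg_neg (contract R g (boundaryMap R _)), ← boundaryMap_contract,
      contract_wedge_of_mem_chains_link hb, hbz, add_neg_cancel]
  have hsum : z + boundaryMap R (wedge R g b) ∈ X.boundaries R m := by
    refine mem_boundaries_of_cone hyg hcone (mem_supported_of_contract_eq_zero
      (Submodule.add_mem _ hzX (boundaryMap_mem_chains hwedge)) hcontract) ?_
    rw [map_add, hz0, boundaryMap_boundaryMap, add_zero]
  rw [← add_sub_cancel_right z (boundaryMap R (wedge R g b))]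
  exact Submodule.sub_mem _ hsum ⟨_, hwedge, rfl⟩

theorem exists_mem_cycles_contract_eq {g y : V} (hyg : y ≠ g)
    (hcone : ∀ σ ∈ X, g ∉ σ → insert y σ ∈ X) {z : Finset V →₀ R}
    (hz : z ∈ (X.link {g}).cycles R m) : ∃ w ∈ X.cycles R (m + 1), contract R g w = z := by
  obtain ⟨hzX, hz0⟩ := mem_cycles.1 hz
  have hdel : z ∈ Finsupp.supported R R {σ | (σ ∈ X ∧ #σ = m) ∧ g ∉ σ} := fun σ hσ => by
    obtain ⟨hg, hgσ⟩ := mem_link_singleton.1 (hzX hσ).1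
    exact ⟨⟨X.down_closed _ hgσ _ (subset_insert g σ), (hzX hσ).2⟩, hg⟩
  have hy := wedge_mem_supported_of_cone hyg hcone hdel
  refine ⟨wedge R g z - wedge R y z, mem_cycles.2 ⟨Submodule.sub_mem _
    (wedge_mem_chains_of_mem_chains_link hzX)
    (Finsupp.supported_mono (fun σ hσ => hσ.1) hy), ?_⟩, ?_⟩
  · rw [map_sub, boundaryMap_wedge, boundaryMap_wedge, hz0, map_zero, map_zero, sub_self]
  · rw [map_sub, contract_wedge_of_mem_chains_link hzX, contract_eq_zero (fun σ hσ => hσ.2) hy,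
      sub_zero]

-- `X` is the union of the star of `g` and the deletion of `g`, both cones, which meet in the link.
theorem nonempty_reducedHomology_equiv_link (R : Type*) [CommRing R] {g y : V} (hyg : y ≠ g)
    (hcone : ∀ σ ∈ X, g ∉ σ → insert y σ ∈ X) (m : ℕ) :
    Nonempty (X.reducedHomology R (m + 1) ≃ₗ[R] (X.link {g}).reducedHomology R m) := by
  refine nonempty_map_mkQ_equiv (contract R g) ?_ ?_ ?_ ?_
  · intro z hz
    obtain ⟨hzX, hz0⟩ := mem_cycles.1 hz
    refine mem_cycles.2 ⟨contract_mem_chains_link g hzX, ?_⟩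
    rw [boundaryMap_contract, hz0, map_zero, neg_zero]
  · rintro _ ⟨c, hc, rfl⟩
    refine ⟨-contract R g c, Submodule.neg_mem _ (contract_mem_chains_link g hc), ?_⟩
    rw [map_neg, boundaryMap_contract, neg_neg]
  · rintro z hz ⟨b, hb, hbz⟩
    exact mem_boundaries_of_contract_eq_boundaryMap hyg hcone hz hb hbz
  · intro z hz
    obtain ⟨w, hw, rfl⟩ := exists_mem_cycles_contract_eq hyg hcone hz
    exact ⟨w, hw, by rw [sub_self]; exact Submodule.zero_mem _⟩

end Homology

section Sphere

variable {V : Type*} [LinearOrder V] {R : Type*} [CommRing R] {K L X : SimpComplex V}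
  {F T : Finset V} {g v y : V} {d i n : ℕ}

/-- `K` has the reduced homology over `R` of a sphere of dimension `n - 1`: the index is shifted by
one, as for `SimpComplex.reducedHomology`, so that `n = 0` is the case of the empty sphere `{∅}`. -/
def HasSphereHomology (R : Type*) [CommRing R] (K : SimpComplex V) (n : ℕ) : Prop :=
  ∀ m : ℕ, (m = n → Nonempty (K.reducedHomology R m ≃ₗ[R] R)) ∧
    (m ≠ n → Subsingleton (K.reducedHomology R m))

theorem HasSphereHomology.of_equiv (hL : L.HasSphereHomology R n)
    (hKL : ∀ m, Nonempty (K.reducedHomology R m ≃ₗ[R] L.reducedHomology R m)) :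
    K.HasSphereHomology R n := by
  intro m
  obtain ⟨e⟩ := hKL m
  refine ⟨fun hm => ?_, fun hm => ?_⟩
  · obtain ⟨f⟩ := (hL m).1 hm
    exact ⟨e.trans f⟩
  · have := (hL m).2 hm
    exact e.toEquiv.subsingleton

theorem HasSphereHomology.of_link (hyg : y ≠ g) (hcone : ∀ σ ∈ X, g ∉ σ → insert y σ ∈ X)
    (h : (X.link {g}).HasSphereHomology R n) : X.HasSphereHomology R (n + 1) := by
  intro m
  cases m with
  | zero =>
    exact ⟨fun h => absurd h.symm n.succ_ne_zero,
      fun _ => subsingleton_reducedHomology_zero_of_cone R hyg hcone⟩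
  | succ m =>
    obtain ⟨e⟩ := nonempty_reducedHomology_equiv_link R hyg hcone m
    refine ⟨fun hm => ?_, fun hm => ?_⟩
    · obtain ⟨f⟩ := (h m).1 (Nat.succ_injective hm)
      exact ⟨e.trans f⟩
    · have := (h m).2 (ne_of_apply_ne (· + 1) hm)
      exact e.toEquiv.subsingleton

theorem HasSphereHomology.join_boundaryComplex (hL : L.HasSphereHomology R n) {G : Finset V}
    (hG0 : G.Nonempty) (hG : ∀ τ ∈ L, Disjoint G τ) :
    (join (boundaryComplex G) L).HasSphereHomology R (n + (#G - 1)) := by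
  induction hG0 using Finset.Nonempty.cons_induction with
  | singleton g =>
    rwa [join_boundaryComplex_singleton fun τ hτ => disjoint_singleton_left.1 (hG τ hτ)]
  | cons g G hg hG0 ih =>
    obtain ⟨y, hy⟩ := hG0
    have hyg : y ≠ g := ne_of_mem_of_not_mem hy hg
    rw [cons_eq_insert] at hG ⊢
    have hcard : n + (#(insert g G) - 1) = n + (#G - 1) + 1 := by
      have := card_pos.2 ⟨y, hy⟩
      rw [card_insert_of_notMem hg]
      omega
    rw [hcard]
    refine HasSphereHomology.of_link hyg (fun σ hσ hgσ => ?_) ?_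
    · rw [mem_join_boundaryComplex hG] at hσ ⊢
      rw [insert_sdiff_of_mem _ (mem_insert_of_mem hy)]
      refine ⟨hσ.1, fun h => ?_⟩
      exact (mem_insert.1 (h (mem_insert_self g G))).elim hyg.symm hgσ
    · rw [link_join_boundaryComplex_insert hg hG]
      exact ih fun τ hτ => (hG τ hτ).mono_left (subset_insert g G)

theorem HasSphereHomology.exists_mem_card_eq [Nontrivial R] (h : K.HasSphereHomology R n) :
    ∃ σ ∈ K, #σ = n := by
  by_contra! hn
  have hsub : Subsingleton (K.reducedHomology R n) := by
    refine subsingleton_reducedHomology_of_le ?_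
    rw [cycles, chains_eq_bot hn, bot_inf_eq]
    exact bot_le
  obtain ⟨e⟩ := (h n).1 rfl
  exact not_subsingleton R e.symm.toEquiv.subsingleton

theorem nonempty_reducedHomology_stellar_equiv_coneOverStar (R : Type*) [CommRing R] (hF : F ∈ K)
    (hv : {v} ∉ K) (m : ℕ) : Nonempty
      ((K.stellar F v).reducedHomology R m ≃ₗ[R] (K.coneOverStar F v).reducedHomology R m) := by
  have hnotMem_iff (σ : Finset V) :
      σ ∈ K.coneOverStar F v ∧ σ ∉ K.stellar F v ↔ σ ∈ K.coneOverStar F v ∧ F ⊆ σ := by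
    rw [mem_stellar hF hv, ← mem_coneOverStar, not_and_not_right]
    exact ⟨fun h => ⟨h.1, h.2 h.1⟩, fun h => ⟨h.1, fun _ => h.2⟩⟩
  refine nonempty_reducedHomology_equiv_of_toggle R v (fun σ hσ => ?_) (fun σ hσ => ?_) m
  · exact mem_coneOverStar.2 ((mem_stellar hF hv).1 hσ).1
  · have hinsert : insert v σ ∉ K := fun h =>
      notMem_of_singleton_notMem hv h (mem_insert_self v σ)
    rw [hnotMem_iff, hnotMem_iff, subset_insert_iff_of_notMem (notMem_of_singleton_notMem hv hF)]
    refine and_congr_left fun hFσ => ?_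
    rw [mem_coneOverStar, mem_coneOverStar, erase_insert hσ, erase_eq_of_notMem hσ,
      union_eq_left.2 hFσ, or_self, or_iff_right hinsert]

theorem nonempty_reducedHomology_equiv_coneOverStar (R : Type*) [CommRing R] (hF : F ∈ K)
    (hF0 : F.Nonempty) (hv : {v} ∉ K) (m : ℕ) :
    Nonempty (K.reducedHomology R m ≃ₗ[R] (K.coneOverStar F v).reducedHomology R m) := by
  obtain ⟨f, hf⟩ := hF0
  have hfv : f ≠ v := ne_of_mem_of_not_mem hf (notMem_of_singleton_notMem hv hF)
  have hnotMem_iff (σ : Finset V) :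
      σ ∈ K.coneOverStar F v ∧ σ ∉ K ↔ σ.erase v ∪ F ∈ K ∧ v ∈ σ := by
    rw [mem_coneOverStar]
    constructor
    · rintro ⟨h | h, hσ⟩
      · exact absurd h hσ
      · refine ⟨h, by_contra fun hvσ => hσ ?_⟩
        rw [erase_eq_of_notMem hvσ] at h
        exact K.down_closed _ h _ subset_union_left
    · exact fun h => ⟨Or.inr h.1, fun hσ => notMem_of_singleton_notMem hv hσ h.2⟩
  refine nonempty_reducedHomology_equiv_of_toggle R f
    (fun σ hσ => mem_coneOverStar.2 (Or.inl hσ)) (fun σ _ => ?_) m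
  rw [hnotMem_iff, hnotMem_iff, erase_insert_of_ne hfv, insert_union,
    insert_eq_of_mem (mem_union_right _ hf), mem_insert, or_iff_right hfv.symm]

theorem nonempty_reducedHomology_stellar_equiv (R : Type*) [CommRing R] (hF : F ∈ K)
    (hF0 : F.Nonempty) (hv : {v} ∉ K) (m : ℕ) :
    Nonempty ((K.stellar F v).reducedHomology R m ≃ₗ[R] K.reducedHomology R m) := by
  obtain ⟨e⟩ := nonempty_reducedHomology_stellar_equiv_coneOverStar R hF hv m
  obtain ⟨e'⟩ := nonempty_reducedHomology_equiv_coneOverStar R hF hF0 hv m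
  exact ⟨e.trans e'.symm⟩

theorem isHomologySphere_iff : K.IsHomologySphere R d ↔ K.faces.Nonempty ∧ K.size = d ∧
    ∀ σ ∈ K, (K.link σ).HasSphereHomology R (d - #σ) := by
  rw [IsHomologySphere]
  refine and_congr_right fun _ => and_congr_right fun hd => ?_
  refine forall₂_congr fun σ hσ => forall_congr' fun m => ?_
  have hσd : #σ ≤ d := hd ▸ card_le_size hσ
  rw [ne_eq, ne_eq, eq_tsub_iff_add_eq_of_le hσd]

theorem IsHomologySphere.link [Nontrivial R] (hK : K.IsHomologySphere R d) (hF : F ∈ K) :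
    (K.link F).IsHomologySphere R (d - #F) := by
  obtain ⟨-, hd, h⟩ := isHomologySphere_iff.1 hK
  obtain ⟨τ, hτ, hτcard⟩ := (h F hF).exists_mem_card_eq
  refine isHomologySphere_iff.2 ⟨⟨τ, hτ⟩, le_antisymm (Finset.sup_le fun σ hσ => ?_)
    (hτcard ▸ card_le_size hτ), fun σ hσ => ?_⟩
  · obtain ⟨hFσ, hunion⟩ := mem_link.1 hσ
    have hcard := card_le_size hunion
    rw [card_union_of_disjoint hFσ, hd] at hcard
    exact Nat.le_sub_of_add_le' hcard
  · obtain ⟨hFσ, hunion⟩ := mem_link.1 hσ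
    rw [link_link hFσ, Nat.sub_sub, ← card_union_of_disjoint hFσ]
    exact h _ hunion

theorem IsHomologySphere.hasSphereHomology_link_stellar (hK : K.IsHomologySphere R d) (hF : F ∈ K)
    (hv : {v} ∉ K) (hvT : v ∉ T) (hT : T ∈ K.stellar F v) :
    ((K.stellar F v).link T).HasSphereHomology R (d - #T) := by
  obtain ⟨hTK, hFT⟩ := (mem_stellar_of_notMem hF hv hvT).1 hT
  have hlink := (isHomologySphere_iff.1 hK).2.2 T hTK
  by_cases hTF : T ∪ F ∈ K
  · rw [link_stellar_of_union_mem hF hv hTF]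
    exact hlink.of_equiv (nonempty_reducedHomology_stellar_equiv R (sdiff_mem_link hTF)
      (sdiff_nonempty.2 hFT) (singleton_notMem_link hv T))
  · rwa [link_stellar_of_union_notMem hF hv hTF hvT]

theorem IsHomologySphere.hasSphereHomology_link_stellar_insert (hK : K.IsHomologySphere R d)
    (hF : F ∈ K) (hv : {v} ∉ K) (hvT : v ∉ T) (hT : insert v T ∈ K.stellar F v) :
    ((K.stellar F v).link (insert v T)).HasSphereHomology R (d - #(insert v T)) := by
  obtain ⟨-, hd, h⟩ := isHomologySphere_iff.1 hK
  obtain ⟨hTF, hFT⟩ := (insert_mem_stellar hF hv hvT).1 hT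
  have hFT0 : (F \ T).Nonempty := sdiff_nonempty.2 hFT
  have hdisjoint : ∀ τ ∈ K.link (T ∪ F), Disjoint (F \ T) τ := fun τ hτ =>
    (disjoint_of_mem_link hτ).mono_left (sdiff_subset.trans subset_union_right)
  have hcard : d - #(insert v T) = d - #(T ∪ F) + (#(F \ T) - 1) := by
    have hle : #(T ∪ F) ≤ d := hd ▸ card_le_size hTF
    have hpos := card_pos.2 hFT0
    rw [card_insert_of_notMem hvT]
    rw [← union_sdiff_self_eq_union, card_union_of_disjoint disjoint_sdiff] at hle ⊢
    omega
  rw [link_stellar_insert hF hv hTF, hcard]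
  exact (h _ hTF).join_boundaryComplex hFT0 hdisjoint

theorem IsHomologySphere.stellar (hK : K.IsHomologySphere R d) (hF : F ∈ K) (hF0 : F.Nonempty)
    (hv : {v} ∉ K) : (K.stellar F v).IsHomologySphere R d := by
  obtain ⟨σ, hσ, -⟩ := exists_mem_stellar_card_eq hF hF0 hv hF
  refine isHomologySphere_iff.2
    ⟨⟨σ, hσ⟩, (size_stellar hF hF0 hv).trans hK.2.1, fun T hT => ?_⟩
  by_cases hvT : v ∈ T
  · rw [← insert_erase hvT] at hT ⊢
    exact hK.hasSphereHomology_link_stellar_insert hF hv (notMem_erase v T) hT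
  · exact hK.hasSphereHomology_link_stellar hF hv hvT hT

theorem IsHS.link [Nontrivial R] (hK : K.IsHS R i d) (hF : F ∈ K) :
    (K.link F).IsHS R i (d - #F) := by
  refine ⟨hK.1.link hF, fun M hM => ?_⟩
  rcases Nat.lt_or_ge 1 #M with hcard | hcard
  · obtain ⟨N, hMN, hN⟩ := hM.exists_superset_of_link hcard
    exact (card_le_card hMN).trans (hK.2 N hN)
  · exact hcard.trans (Nat.le_add_left 1 i)

theorem IsHS.stellar (hK : K.IsHS R i d) (hF : F ∈ K) (hF0 : F.Nonempty) (hFi : #F ≤ i + 1)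
    (hv : {v} ∉ K) : (K.stellar F v).IsHS R i d := by
  refine ⟨hK.1.stellar hF hF0 hv, fun M hM => ?_⟩
  by_cases hvM : v ∈ M
  · obtain ⟨N, hMN, hN⟩ := hM.exists_card_le_of_stellar_of_mem hF hv hvM
    exact hMN.trans (hK.2 N hN)
  · obtain rfl | hM := hM.eq_or_of_stellar_of_notMem hF hv hvM
    · exact hFi
    · exact hK.2 M hM

end Sphere

section Euler

universe u

theorem finrank_map_add_finrank_inf_ker {R : Type*} [Ring R] [HasRankNullity.{u} R] {M : Type u}
    {N : Type*} [AddCommGroup M] [Module R M] [AddCommGroup N] [Module R N] (Z : Submodule R M)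
    (hZ : Module.rank R Z < Cardinal.aleph0) (f : M →ₗ[R] N) :
    Module.finrank R (Z.map f) + Module.finrank R ↥(Z ⊓ LinearMap.ker f) =
      Module.finrank R Z := by
  let g := f.domRestrict Z
  have hrank := HasRankNullity.rank_quotient_add_rank (LinearMap.ker g)
  have hquotient : Module.rank R (Z ⧸ LinearMap.ker g) < Cardinal.aleph0 :=
    (hrank ▸ self_le_add_right _ _).trans_lt hZ
  have hker : Module.rank R (LinearMap.ker g) < Cardinal.aleph0 :=
    (hrank ▸ self_le_add_left _ _).trans_lt hZ
  have hmap : Module.finrank R (Z.map f) = Module.finrank R (Z ⧸ LinearMap.ker g) := by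
    rw [g.quotKerEquivRange.finrank_eq, LinearMap.range_domRestrict]
  have hinf : Module.finrank R ↥(Z ⊓ LinearMap.ker f) = Module.finrank R (LinearMap.ker g) := by
    rw [LinearMap.ker_domRestrict, LinearEquiv.finrank_eq (Submodule.equivSubtypeMap _ _),
      Submodule.map_comap_subtype]
  rw [hmap, hinf, Module.finrank, Module.finrank, Module.finrank,
    ← Cardinal.toNat_add hquotient hker, hrank]

theorem nonempty_chains_equiv {V : Type*} (R : Type*) [CommRing R] (K : SimpComplex V) (m : ℕ) :
    Nonempty (K.chains R m ≃ₗ[R] (({σ ∈ K.faces | #σ = m} : Finset (Finset V)) →₀ R)) := by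
  have hfaces : {σ | σ ∈ K ∧ #σ = m} = ({σ ∈ K.faces | #σ = m} : Finset (Finset V)) :=
    (coe_filter _ _).symm
  exact ⟨(LinearEquiv.ofEq _ _ (by rw [chains, hfaces])).trans (Finsupp.supportedEquivFinsupp _)⟩

theorem finrank_chains {V : Type*} (R : Type*) [CommRing R] [Nontrivial R] (K : SimpComplex V)
    (m : ℕ) : Module.finrank R (K.chains R m) = K.fNum m := by
  obtain ⟨e⟩ := nonempty_chains_equiv R K m
  rw [e.finrank_eq, Module.finrank_finsupp_self, Fintype.card_coe, fNum]

theorem rank_chains_lt_aleph0 {V : Type*} (R : Type*) [CommRing R] [Nontrivial R]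
    (K : SimpComplex V) (m : ℕ) : Module.rank R (K.chains R m) < Cardinal.aleph0 := by
  obtain ⟨e⟩ := nonempty_chains_equiv R K m
  have : Module.Finite R (K.chains R m) := Module.Finite.equiv e.symm
  exact Module.rank_lt_aleph0 R _

variable {V : Type*} [LinearOrder V]

theorem cycles_zero (R : Type*) [CommRing R] (K : SimpComplex V) :
    K.cycles R 0 = K.chains R 0 := by
  refine inf_eq_left.2 fun c hc => (Submodule.mem_bot R).1
    (map_mem_of_mem_supported (boundaryMap R) (fun σ hσ r => ?_) hc)
  rw [boundaryMap_single, card_eq_zero.1 hσ.2, sum_empty]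
  exact Submodule.zero_mem _

variable (R : Type*) [CommRing R] [IsDomain R]

theorem finrank_boundaries_add_finrank_cycles (K : SimpComplex V) (m : ℕ) :
    Module.finrank R (K.boundaries R m) + Module.finrank R (K.cycles R (m + 1)) =
      K.fNum (m + 1) := by
  rw [← finrank_chains R K (m + 1)]
  exact finrank_map_add_finrank_inf_ker _ (rank_chains_lt_aleph0 R K (m + 1)) _

theorem finrank_reducedHomology_add_finrank_boundaries (K : SimpComplex V) (m : ℕ) :
    Module.finrank R (K.reducedHomology R m) + Module.finrank R (K.boundaries R m) =
      Module.finrank R (K.cycles R m) := by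
  have hrank : Module.rank R (K.cycles R m) < Cardinal.aleph0 :=
    (Submodule.rank_mono inf_le_left).trans_lt (rank_chains_lt_aleph0 R K m)
  have h := finrank_map_add_finrank_inf_ker _ hrank (K.boundaries R m).mkQ
  rwa [Submodule.ker_mkQ, inf_eq_right.2 (boundaries_le_cycles R K m)] at h

theorem sum_fNum_eq_sum_finrank_reducedHomology (K : SimpComplex V) (N : ℕ) :
    ∑ m ∈ range (N + 1), (-1 : ℤ) ^ m * K.fNum m =
      ∑ m ∈ range (N + 1), (-1 : ℤ) ^ m * Module.finrank R (K.reducedHomology R m) +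
        (-1) ^ N * Module.finrank R (K.boundaries R N) := by
  induction N with
  | zero =>
    have h := finrank_reducedHomology_add_finrank_boundaries R K 0
    rw [cycles_zero, finrank_chains] at h
    simp only [zero_add, sum_range_one, pow_zero, one_mul]
    exact_mod_cast h.symm
  | succ N ih =>
    rw [sum_range_succ, ih, sum_range_succ _ (N + 1),
      ← finrank_boundaries_add_finrank_cycles R K N,
      ← finrank_reducedHomology_add_finrank_boundaries R K (N + 1)]
    push_cast
    ring

theorem sum_neg_one_pow_card_eq_sum_fNum {V : Type*} (K : SimpComplex V) :
    ∑ σ ∈ K.faces, (-1 : ℤ) ^ #σ = ∑ m ∈ range (K.size + 1), (-1 : ℤ) ^ m * K.fNum m := by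
  rw [← sum_fiberwise_of_maps_to (t := range (K.size + 1)) (g := card)
    fun σ hσ => mem_range_succ_iff.2 (card_le_size hσ)]
  refine sum_congr rfl fun m _ => ?_
  rw [fNum, sum_congr rfl fun σ hσ => by rw [(mem_filter.1 hσ).2], sum_const, nsmul_eq_mul,
    mul_comm]

theorem sum_neg_one_pow_card_eq_sum_finrank_reducedHomology (K : SimpComplex V) :
    ∑ σ ∈ K.faces, (-1 : ℤ) ^ #σ = ∑ m ∈ range (K.size + 1),
      (-1 : ℤ) ^ m * Module.finrank R (K.reducedHomology R m) := by
  rw [sum_neg_one_pow_card_eq_sum_fNum, sum_fNum_eq_sum_finrank_reducedHomology R, boundaries,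
    chains_eq_bot fun σ hσ => (Nat.lt_succ_of_le (card_le_size hσ)).ne, Submodule.map_bot,
    finrank_bot, Nat.cast_zero, mul_zero, add_zero]

variable {R}

theorem HasSphereHomology.sum_neg_one_pow_card {K : SimpComplex V} {n : ℕ}
    (h : K.HasSphereHomology R n) : ∑ σ ∈ K.faces, (-1 : ℤ) ^ #σ = (-1) ^ n := by
  obtain ⟨σ, hσ, hσn⟩ := h.exists_mem_card_eq
  rw [sum_neg_one_pow_card_eq_sum_finrank_reducedHomology R, sum_eq_single_of_mem n
    (mem_range_succ_iff.2 (hσn ▸ card_le_size hσ)) fun m _ hm => ?_]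
  · obtain ⟨e⟩ := (h n).1 rfl
    rw [e.finrank_eq, Module.finrank_self, Nat.cast_one, mul_one]
  · have := (h m).2 hm
    rw [Module.finrank_zero_of_subsingleton, Nat.cast_zero, mul_zero]

end Euler

section HPoly

theorem one_sub_X_pow_eq_sum {R : Type*} [CommRing R] (n : ℕ) :
    (1 - X : R[X]) ^ n = ∑ k ∈ range (n + 1), C ((-1) ^ k * (n.choose k : R)) * X ^ k := by
  rw [sub_eq_neg_add, add_pow]
  refine sum_congr rfl fun k _ => ?_
  rw [neg_pow, one_pow, mul_one, mul_right_comm]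
  simp only [C_mul, C_pow, C_neg, C_1, map_natCast]

theorem natDegree_one_sub_X_pow_le {R : Type*} [Ring R] (n : ℕ) :
    ((1 - X : R[X]) ^ n).natDegree ≤ n := by
  have h : (1 - X : R[X]).natDegree ≤ 1 :=
    natDegree_sub_le_of_le (natDegree_one.trans_le zero_le_one) natDegree_X_le
  simpa only [mul_one] using natDegree_pow_le_of_le n h

theorem reflect_one_sub_X_pow {R : Type*} [Ring R] (n : ℕ) :
    reflect n ((1 - X : R[X]) ^ n) = (X - 1) ^ n := by
  induction n with
  | zero => rw [pow_zero, pow_zero, reflect_one, pow_zero]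
  | succ n ih =>
    have h : (1 - X : R[X]).natDegree ≤ 1 := by simpa using natDegree_one_sub_X_pow_le (R := R) 1
    rw [pow_succ, reflect_mul _ _ (natDegree_one_sub_X_pow_le n) h, ih, pow_succ, reflect_sub,
      reflect_one, reflect_one_X, pow_one]

theorem reflect_sum {R ι : Type*} [Semiring R] (s : Finset ι) (f : ι → R[X]) (n : ℕ) :
    reflect n (∑ a ∈ s, f a) = ∑ a ∈ s, reflect n (f a) :=
  map_sum (⟨⟨reflect n, reflect_zero⟩, fun p q => reflect_add p q n⟩ : R[X] →+ R[X]) f s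

theorem sum_powerset_pow_mul_pow {α R : Type*} [CommSemiring R] (a b : R) {s : Finset α} {n : ℕ}
    (hs : #s ≤ n) :
    ∑ t ∈ s.powerset, a ^ #t * b ^ (n - #t) = b ^ (n - #s) * (a + b) ^ #s := by
  rw [← sum_pow_mul_eq_add_pow, mul_sum]
  refine sum_congr rfl fun t ht => ?_
  have hts := card_le_card (mem_powerset.1 ht)
  rw [mul_left_comm, ← pow_add]
  congr 2
  omega

variable {V : Type*}

theorem hNum_eq_sum (K : SimpComplex V) (m : ℕ) : K.hNum m = ∑ σ ∈ K.faces,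
    if #σ ≤ m then (-1 : ℤ) ^ (m - #σ) * ((K.size - #σ).choose (m - #σ) : ℤ) else 0 := by
  have hfNum (j : ℕ) : (K.fNum j : ℤ) = ∑ σ ∈ K.faces, if j = #σ then 1 else 0 := by
    simp only [fNum, card_filter, Nat.cast_sum, Nat.cast_ite, Nat.cast_one, Nat.cast_zero, eq_comm]
  simp only [hNum, hfNum, mul_sum, mul_ite, mul_one, mul_zero]
  rw [sum_comm]
  refine sum_congr rfl fun σ _ => ?_
  rw [Finset.sum_ite_eq']
  simp only [mem_range_succ_iff]

theorem hPoly_eq_sum (K : SimpComplex V) :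
    K.hPoly = ∑ σ ∈ K.faces, X ^ #σ * (1 - X) ^ (K.size - #σ) := by
  simp only [hPoly, hNum_eq_sum, map_sum, sum_mul]
  rw [sum_comm]
  refine sum_congr rfl fun σ hσ => ?_
  have hsplit : K.size + 1 = #σ + (K.size - #σ + 1) := by
    rw [← add_assoc, Nat.add_sub_cancel' (card_le_size hσ)]
  rw [hsplit, sum_range_add, sum_eq_zero fun k hk => ?_, zero_add, one_sub_X_pow_eq_sum, mul_sum]
  · refine sum_congr rfl fun k _ => ?_
    rw [if_pos (Nat.le_add_right _ _), Nat.add_sub_cancel_left, pow_add, mul_left_comm]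
  · rw [if_neg (mem_range.1 hk).not_ge, C_0, zero_mul]

theorem natDegree_hPoly_le (K : SimpComplex V) : K.hPoly.natDegree ≤ K.size :=
  natDegree_sum_le_of_forall_le _ _ fun _ hm =>
    (natDegree_C_mul_X_pow_le _ _).trans (mem_range_succ_iff.1 hm)

theorem reflect_hPoly (K : SimpComplex V) :
    reflect K.size K.hPoly = ∑ σ ∈ K.faces, (X - 1) ^ (K.size - #σ) := by
  rw [hPoly_eq_sum, reflect_sum]
  refine sum_congr rfl fun σ hσ => ?_
  have hsize : #σ + (K.size - #σ) = K.size := Nat.add_sub_cancel' (card_le_size hσ)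
  conv_lhs => rw [← hsize]
  rw [Nat.add_sub_cancel_left, reflect_mul _ _ (natDegree_X_pow_le _)
    (natDegree_one_sub_X_pow_le _), reflect_one_sub_X_pow, reflect_monomial, revAt_le le_rfl,
    Nat.sub_self, pow_zero, one_mul]

section DecidableEq

variable [DecidableEq V] {K L : SimpComplex V} {F : Finset V} {v : V}

theorem sum_filter_subset_eq_sum_link {A : Type*} [AddCommMonoid A] (K : SimpComplex V)
    (F : Finset V) (w : ℕ → A) :
    ∑ T ∈ K.faces with F ⊆ T, w #T = ∑ B ∈ (K.link F).faces, w (#F + #B) := by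
  refine sum_nbij' (· \ F) (F ∪ ·) ?_ ?_ ?_ ?_ ?_
  · intro T hT
    obtain ⟨hTK, hFT⟩ := mem_filter.1 hT
    refine sdiff_mem_link ?_
    rwa [union_eq_right.2 hFT]
  · intro B hB
    exact mem_filter.2 ⟨(mem_link.1 hB).2, subset_union_left⟩
  · intro T hT
    exact union_sdiff_of_subset (mem_filter.1 hT).2
  · intro B hB
    exact union_sdiff_cancel_left (disjoint_of_mem_link hB)
  · intro T hT
    rw [add_comm, card_sdiff_add_card_eq_card (mem_filter.1 hT).2]

theorem hPoly_eq_X_pow_mul_hPoly_link_add (hsize : (K.link F).size + #F = K.size) :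
    K.hPoly = X ^ #F * (K.link F).hPoly +
      ∑ T ∈ K.faces with ¬F ⊆ T, X ^ #T * (1 - X) ^ (K.size - #T) := by
  rw [hPoly_eq_sum, ← sum_filter_add_sum_filter_not K.faces (F ⊆ ·), hPoly_eq_sum (K.link F),
    sum_filter_subset_eq_sum_link K F fun n => X ^ n * (1 - X : ℤ[X]) ^ (K.size - n), mul_sum]
  congr 1
  refine sum_congr rfl fun B _ => ?_
  rw [← hsize, add_comm #F, Nat.add_sub_add_right, add_comm #B, pow_add, mul_assoc]

theorem size_join (hK : K.faces.Nonempty) (hL : L.faces.Nonempty)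
    (hKL : ∀ σ ∈ K, ∀ τ ∈ L, Disjoint σ τ) : (join K L).size = K.size + L.size := by
  refine le_antisymm (Finset.sup_le fun ρ hρ => ?_) ?_
  · obtain ⟨σ, hσ, τ, hτ, rfl⟩ := mem_join.1 hρ
    exact (card_union_le σ τ).trans (add_le_add (card_le_size hσ) (card_le_size hτ))
  · obtain ⟨σ, hσ, hσcard⟩ := exists_mem_card_eq_size hK
    obtain ⟨τ, hτ, hτcard⟩ := exists_mem_card_eq_size hL
    rw [← hσcard, ← hτcard, ← card_union_of_disjoint (hKL σ hσ τ hτ)]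
    exact card_le_size (mem_join.2 ⟨σ, hσ, τ, hτ, rfl⟩)

theorem sum_join {A : Type*} [AddCommMonoid A] (hKL : ∀ σ ∈ K, ∀ τ ∈ L, Disjoint σ τ)
    (w : ℕ → A) : ∑ ρ ∈ (join K L).faces, w #ρ =
      ∑ σ ∈ K.faces, ∑ τ ∈ L.faces, w (#σ + #τ) := by
  have hinj : Set.InjOn (Function.uncurry (· ∪ ·))
      (↑(K.faces ×ˢ L.faces) : Set (Finset V × Finset V)) := by
    have hle {σ τ σ' τ' : Finset V} (hdisjoint : Disjoint σ τ' ∧ Disjoint σ' τ)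
        (h : σ ∪ τ = σ' ∪ τ') : σ ⊆ σ' ∧ τ ⊆ τ' :=
      ⟨hdisjoint.1.left_le_of_le_sup_right (subset_union_left.trans_eq h),
        hdisjoint.2.symm.left_le_of_le_sup_left (subset_union_right.trans_eq h)⟩
    rintro ⟨σ, τ⟩ hp ⟨σ', τ'⟩ hp' (h : σ ∪ τ = σ' ∪ τ')
    obtain ⟨hσ, hτ⟩ := mem_product.1 hp
    obtain ⟨hσ', hτ'⟩ := mem_product.1 hp'
    have hsub := hle ⟨hKL σ hσ τ' hτ', hKL σ' hσ' τ hτ⟩ h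
    have hsup := hle ⟨hKL σ' hσ' τ hτ, hKL σ hσ τ' hτ'⟩ h.symm
    exact Prod.ext (hsub.1.antisymm hsup.1) (hsub.2.antisymm hsup.2)
  have hfaces : (join K L).faces = (K.faces ×ˢ L.faces).image (Function.uncurry (· ∪ ·)) :=
    (image_uncurry_product _ _ _).symm
  rw [hfaces, sum_image hinj, sum_product]
  exact sum_congr rfl fun σ hσ => sum_congr rfl fun τ hτ =>
    congrArg w (card_union_of_disjoint (hKL σ hσ τ hτ))

theorem hPoly_join (hK : K.faces.Nonempty) (hL : L.faces.Nonempty)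
    (hKL : ∀ σ ∈ K, ∀ τ ∈ L, Disjoint σ τ) : (join K L).hPoly = K.hPoly * L.hPoly := by
  rw [hPoly_eq_sum, size_join hK hL hKL,
    sum_join hKL fun n => X ^ n * (1 - X : ℤ[X]) ^ (K.size + L.size - n), hPoly_eq_sum K,
    hPoly_eq_sum L, sum_mul_sum]
  refine sum_congr rfl fun σ hσ => sum_congr rfl fun τ hτ => ?_
  rw [mul_mul_mul_comm, ← pow_add, ← pow_add,
    tsub_add_tsub_comm (card_le_size hσ) (card_le_size hτ)]

theorem boundaryComplex_faces_nonempty (hF : F.Nonempty) :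
    (boundaryComplex F).faces.Nonempty :=
  ⟨∅, mem_boundaryComplex.2 hF.empty_ssubset⟩

theorem size_boundaryComplex (hF : F.Nonempty) : (boundaryComplex F).size = #F - 1 := by
  refine le_antisymm (Finset.sup_le fun σ hσ =>
    Nat.le_sub_one_of_lt (card_lt_card (mem_boundaryComplex.1 hσ))) ?_
  obtain ⟨x, hx⟩ := hF
  rw [← card_erase_of_mem hx]
  exact card_le_size (mem_boundaryComplex.2 (erase_ssubset hx))

theorem hPoly_boundaryComplex (hF : F.Nonempty) :
    (boundaryComplex F).hPoly = geomPoly (#F - 1) := by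
  have hX : (X - 1 : ℤ[X]) ≠ 0 := X_sub_C_ne_zero 1
  have hpos := card_pos.2 hF
  have hsum : (1 - X) * (boundaryComplex F).hPoly + X ^ #F = (1 : ℤ[X]) := by
    have hpowerset : ∑ σ ∈ F.powerset, X ^ #σ * (1 - X : ℤ[X]) ^ (#F - #σ) = 1 := by
      rw [sum_pow_mul_eq_add_pow, add_sub_cancel, one_pow]
    rw [← sum_erase_add _ _ (mem_powerset_self F), Nat.sub_self, pow_zero, mul_one] at hpowerset
    refine Eq.trans (congrArg (· + X ^ #F) ?_) hpowerset
    rw [hPoly_eq_sum, size_boundaryComplex hF, mul_sum]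
    refine sum_congr rfl fun σ hσ => ?_
    have hlt := card_lt_card (mem_boundaryComplex.1 hσ)
    rw [mul_left_comm, ← pow_succ', Nat.sub_right_comm,
      Nat.sub_add_cancel (Nat.sub_pos_of_lt hlt)]
  apply mul_left_cancel₀ hX
  rw [X_sub_one_mul_geomPoly, Nat.sub_add_cancel hpos]
  linear_combination -hsum

theorem hPoly_stellar_add (hF : F ∈ K) (hF0 : F.Nonempty) (hv : {v} ∉ K)
    (hsize : (K.link F).size + #F = K.size) :
    (K.stellar F v).hPoly + X ^ #F * (K.link F).hPoly =
      K.hPoly + X * geomPoly (#F - 1) * (K.link F).hPoly := by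
  have hdisjoint : ∀ σ ∈ boundaryComplex F, ∀ τ ∈ K.link F, Disjoint σ τ := fun σ hσ τ hτ =>
    (disjoint_of_mem_link hτ).mono_left (mem_boundaryComplex.1 hσ).1
  have hboundary := boundaryComplex_faces_nonempty hF0
  have hlink : (K.link F).faces.Nonempty :=
    ⟨∅, mem_link.2 ⟨disjoint_empty_right F, by rwa [union_empty]⟩⟩
  have hlink_v : ((K.stellar F v).link {v}).hPoly = geomPoly (#F - 1) * (K.link F).hPoly := by
    rw [link_stellar_singleton hF hv, hPoly_join hboundary hlink hdisjoint,
      hPoly_boundaryComplex hF0]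
  have hsize_v : ((K.stellar F v).link {v}).size + #({v} : Finset V) = (K.stellar F v).size := by
    have hpos := card_pos.2 hF0
    rw [link_stellar_singleton hF hv, size_join hboundary hlink hdisjoint,
      size_boundaryComplex hF0, size_stellar hF hF0 hv, card_singleton]
    omega
  have hfaces : {T ∈ (K.stellar F v).faces | ¬{v} ⊆ T} = {T ∈ K.faces | ¬F ⊆ T} := by
    ext T
    rw [mem_filter, mem_filter, singleton_subset_iff]
    exact ⟨fun h => (mem_stellar_of_notMem hF hv h.2).1 h.1, fun h =>
      have hvT := notMem_of_singleton_notMem hv h.1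
      ⟨(mem_stellar_of_notMem hF hv hvT).2 h, hvT⟩⟩
  rw [hPoly_eq_X_pow_mul_hPoly_link_add hsize_v, hPoly_eq_X_pow_mul_hPoly_link_add hsize, hlink_v,
    hfaces, size_stellar hF hF0 hv, card_singleton, pow_one]
  ring

theorem hPoly_stellar_mem_gCone {i : ℕ} (hi : 1 ≤ i) (hF : F ∈ K) (hF0 : F.Nonempty)
    (hFi : #F ≤ i + 2) (hv : {v} ∉ K) (hsize : (K.link F).size + #F = K.size)
    (hK : K.hPoly ∈ gCone i K.size) (hlink : (K.link F).hPoly ∈ gCone i (K.link F).size) :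
    (K.stellar F v).hPoly ∈ gCone i K.size := by
  have h := hPoly_stellar_add hF hF0 hv hsize
  obtain hF1 | ⟨a, ha⟩ : #F = 1 ∨ ∃ a, #F = a + 2 := by
    rcases Nat.exists_eq_succ_of_ne_zero (card_ne_zero.2 hF0) with ⟨_ | a, ha⟩
    exacts [Or.inl ha, Or.inr ⟨a, ha⟩]
  · rw [hF1, Nat.sub_self, geomPoly_zero, pow_one, mul_one] at h
    rwa [add_right_cancel h]
  · have hstellar : (K.stellar F v).hPoly =
        K.hPoly + X ^ 1 * (geomPoly a * (K.link F).hPoly) := by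
      rw [ha, show a + 2 - 1 = a + 1 from rfl, geomPoly_succ] at h
      linear_combination h
    rw [hstellar]
    exact Submodule.add_mem _ hK
      (X_pow_mul_mem_span_gBasis (by omega) (geomPoly_mul_mem_gCone hi (by omega) hlink))

end DecidableEq

section DehnSommerville

variable [LinearOrder V] {R : Type*} [CommRing R] [IsDomain R] {K : SimpComplex V} {d : ℕ}
  {σ : Finset V}

theorem IsHomologySphere.sum_filter_subset_neg_one_pow (hK : K.IsHomologySphere R d)
    (hσ : σ ∈ K) : ∑ τ ∈ K.faces with σ ⊆ τ, (-1 : ℤ) ^ (d - #τ) = 1 := by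
  obtain ⟨-, hd, h⟩ := isHomologySphere_iff.1 hK
  have hshift : ∀ τ ∈ (K.link σ).faces,
      (-1 : ℤ) ^ (d - (#σ + #τ)) = (-1) ^ (d - #σ) * (-1) ^ #τ := by
    intro τ hτ
    obtain ⟨hστ, hunion⟩ := mem_link.1 hτ
    have hle := card_le_size hunion
    rw [card_union_of_disjoint hστ, hd] at hle
    rw [show d - #σ = d - (#σ + #τ) + #τ by omega, pow_add, mul_assoc, ← mul_pow, neg_one_mul,
      neg_neg, one_pow, mul_one]
  rw [sum_filter_subset_eq_sum_link K σ fun n => (-1 : ℤ) ^ (d - n), sum_congr rfl hshift,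
    ← mul_sum, (h σ hσ).sum_neg_one_pow_card, ← mul_pow, neg_one_mul, neg_neg, one_pow]

/- Dehn–Sommerville: expand each term of `h` over the faces `τ ⊇ σ` with the signs of the Euler
relation above, then sum over `σ ⊆ τ` by the binomial theorem. -/
theorem IsHomologySphere.isPalindromic_hPoly (hK : K.IsHomologySphere R d) :
    IsPalindromic d K.hPoly := by
  obtain rfl : K.size = d := hK.2.1
  refine ⟨natDegree_hPoly_le K, ?_⟩
  rw [reflect_hPoly, hPoly_eq_sum]
  symm
  calc ∑ σ ∈ K.faces, X ^ #σ * (1 - X : ℤ[X]) ^ (K.size - #σ)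
      = ∑ σ ∈ K.faces, ∑ τ ∈ K.faces with σ ⊆ τ,
          (-1) ^ (K.size - #τ) * (X ^ #σ * (1 - X) ^ (K.size - #σ)) := by
        refine sum_congr rfl fun σ hσ => ?_
        have h := congrArg (Int.cast : ℤ → ℤ[X]) (hK.sum_filter_subset_neg_one_pow hσ)
        push_cast at h
        rw [← sum_mul, h, one_mul]
    _ = ∑ τ ∈ K.faces, ∑ σ ∈ τ.powerset,
          (-1) ^ (K.size - #τ) * (X ^ #σ * (1 - X) ^ (K.size - #σ)) := by
        refine sum_comm' fun σ τ => ?_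
        rw [mem_filter, mem_powerset]
        exact ⟨fun h => ⟨h.2.2, h.2.1⟩, fun h => ⟨K.down_closed _ h.2 _ h.1, h.2, h.1⟩⟩
    _ = ∑ τ ∈ K.faces, (X - 1) ^ (K.size - #τ) := by
        refine sum_congr rfl fun τ hτ => ?_
        rw [← mul_sum, sum_powerset_pow_mul_pow _ _ (card_le_size hτ), add_sub_cancel, one_pow,
          mul_one, ← mul_pow, neg_one_mul, neg_sub]

end DehnSommerville

end HPoly

end SimpComplex

theorem mainTheorem8 {V : Type*} [LinearOrder V] (R : Type*) [CommRing R] [IsDomain R]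
    (i d : ℕ) (hi : 1 ≤ i) (hd : 1 ≤ d)
    (Δ : SimpComplex V) (hΔ : Δ.IsHS R i d)
    (F : Finset V) (hF : F ∈ Δ) (hF0 : F.Nonempty) (hFi : F.card ≤ i + 1)
    (v : V) (hv : {v} ∉ Δ) :
    (Δ.link F).IsHS R i (d - F.card) ∧
    (Δ.stellar F v).IsHS R i d ∧
    InGSpan i d Δ.hPoly ∧
    InGSpan i (d - F.card) (Δ.link F).hPoly ∧
    InGSpan i d (Δ.stellar F v).hPoly ∧
    (0 ≤ gVector i d Δ.hPoly →
      0 ≤ gVector i (d - F.card) (Δ.link F).hPoly →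
      0 ≤ gVector i d (Δ.stellar F v).hPoly) := by
  have hlink := hΔ.link hF
  have hstellar := hΔ.stellar hF hF0 hFi hv
  have hΔ_span := hΔ.1.isPalindromic_hPoly.inGSpan hi
  have hlink_span := hlink.1.isPalindromic_hPoly.inGSpan hi
  have hstellar_span := hstellar.1.isPalindromic_hPoly.inGSpan hi
  refine ⟨hlink, hstellar, hΔ_span, hlink_span, hstellar_span, ?_⟩
  rw [← mem_gCone_iff_gVector_nonneg hΔ_span, ← mem_gCone_iff_gVector_nonneg hlink_span,
    ← mem_gCone_iff_gVector_nonneg hstellar_span]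
  obtain rfl : Δ.size = d := hΔ.1.2.1
  have hsize : (Δ.link F).size + #F = Δ.size := by
    rw [hlink.1.2.1, Nat.sub_add_cancel (SimpComplex.card_le_size hF)]
  intro hΔ_cone hlink_cone
  rw [← hlink.1.2.1] at hlink_cone
  exact SimpComplex.hPoly_stellar_mem_gCone hi hF hF0 (Nat.le_succ_of_le hFi) hv hsize hΔ_cone
    hlink_cone
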